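/- **Theorem 1.1.** Let $\Omega\subset\mathbb R^3$ be a bounded domain with $C^2$ boundary and outward unit normal $\nu$, let $k\ge 0$, let $D$ be a nonempty open set with $\overline D\subset\Omega$, let $\rho\in L^2(D)$ be complex-valued, and let $F_{\rho,D}=\rho$ on $D$, $F_{\rho,D}=0$ on $\Omega\setminus D$. Let $u\in H^1(\Omega)$ be a weak solution of $\Delta u+k^2u=F_{\rho,D}$ in $\Omega$, with Cauchy data on $\partial\Omega$: the trace $u|_{\partial\Omega}$ and the weak normal derivative $\partial u/\partial\nu$, i.e. the functional $\langle\partial u/\partial\nu,w|_{\partial\Omega}\rangle=\int_\Omega\{\nabla u\cdot\nabla w+(F_{\rho,D}-k^2u)w\}\,dx$, $w\in H^1(\Omega)$. Let $\omega\in S^2$ and $h_D(\omega)=\sup_{x\in D}x\cdot\omega$. Suppose that $\omega$ is regular with respect to $D$, i.e. $\{x\in\overline D: x\cdot\omega=h_D(\omega)\}$ is a single point $p=p(\omega)$, and that $D$ has a conical singularity from direction $\omega$, i.e. for some $\delta>0$ and some nonempty bounded relatively open subset $Q$ of the plane $x\cdot\omega=h_D(\omega)-\delta$, $$D\cap\{h_D(\omega)-\delta<x\cdot\omega<h_D(\omega)\}=D_{(p,\omega)}(\delta,Q):=\bigcup_{0<s<\delta}\Big\{p+\frac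 s\delta(z-p): z\in Q\Big\}.$$ Suppose also that for some $\eta>0$, $0<\alpha\le1$ there is $\tilde\rho\in C^{0,\alpha}(\overline{B_\eta(p)})$ with $\rho=\tilde\rho$ a.e. in $B_\eta(p)\cap D$. For $\vartheta\in S(\omega)=\{\vartheta\in S^2:\omega\cdot\vartheta=0\}$ and $0<s<\delta$ put $Q_s=D_{(p,\omega)}(\delta,Q)\cap\{x\cdot\omega=p\cdot\omega-s\}$ and $$C_{(p,\omega)}(\delta,Q,\vartheta)=2s\int_{Q_s}\frac{dS_z}{\{s-i(z-p)\cdot\vartheta\}^3}$$ (this does not depend on $s$). For $\tau>0$ put $v=e^{x\cdot(\tau\omega+i\sqrt{\tau^2+k^2}\,\vartheta)}$, $v_\tau=\partial_\tau v=\{x\cdot(\omega+i\frac{\tau}{\sqrt{\tau^2+k^2}}\vartheta)\}v$ and $$I_{\omega,\vartheta}(\tau)=\int_{\partial\Omega}\Big(\frac{\partial u}{\partial\nu}v-\frac{\partial v}{\partial\nu}u\Big)dS,\qquad I'_{\omega,\vartheta}(\tau)=\int_{\partial\Omega}\Big(\frac{\partial u}{\partial\nu}v_\tau-\frac{\partial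 v_\tau}{\partial\nu}u\Big)dS,$$ where the terms with $\partial u/\partial\nu$ are understood as the pairings above. Then $I'_{\omega,\vartheta}$ is the derivative of $I_{\omega,\vartheta}$ with respect to $\tau$ on $(0,\infty)$ and, as $\tau\to\infty$, $$\tau^3e^{-\tau h_D(\omega)}e^{-i\sqrt{\tau^2+k^2}\,p\cdot\vartheta}I_{\omega,\vartheta}(\tau)=\tilde\rho(p)\,C_{(p,\omega)}(\delta,Q,\vartheta)+O(\tau^{-\alpha}),$$ $$\tau^3e^{-\tau h_D(\omega)}e^{-i\sqrt{\tau^2+k^2}\,p\cdot\vartheta}I'_{\omega,\vartheta}(\tau)=\tilde\rho(p)\,(h_D(\omega)+ip\cdot\vartheta)\,C_{(p,\omega)}(\delta,Q,\vartheta)+O(\tau^{-\alpha}).$$ Both remainders are uniform with respect to $\vartheta\in S(\omega)$. -/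

import Mathlib

open MeasureTheory Filter Set
open scoped Topology NNReal ENNReal

/-- Euclidean three-space. -/
abbrev E3 : Type := EuclideanSpace ℝ (Fin 3)

/-- The dot product `x · y` of two vectors of Euclidean three-space. -/
noncomputable def dot (x y : E3) : ℝ := inner ℝ x y

/-! ### Domains with twice continuously differentiable boundary -/

/-- `Ω` is a bounded domain of `ℝ³` with `∂Ω ∈ C²`: it is open, connected and bounded, and near every
boundary point, after an orthogonal change of coordinates, it is the region strictly below the
graph of a `C²` function of two variables. -/
structure IsBoundedC2Domain (Ω : Set E3) : Prop where
  isOpen : IsOpen Ω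
  isConnected : IsConnected Ω
  isBounded : Bornology.IsBounded Ω
  boundary : ∀ x ∈ frontier Ω, ∃ (r : ℝ) (R : E3 ≃ₗᵢ[ℝ] E3) (γ : EuclideanSpace ℝ (Fin 2) → ℝ),
    0 < r ∧ ContDiff ℝ 2 γ ∧
      ∀ y ∈ Metric.ball x r, (y ∈ Ω ↔ (R y) 2 < γ !₂[(R y) 0, (R y) 1])

/-- `n` is the outward unit normal to `∂Ω` at `x`: it has length one and, to first order at `x`, the
set `Ω` is the half space `(y - x) · n < 0`. -/
def IsOutwardUnitNormal (Ω : Set E3) (x n : E3) : Prop :=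
  ‖n‖ = 1 ∧ ∀ ε > (0 : ℝ), ∀ᶠ y in 𝓝 x,
    (dot (y - x) n < -(ε * ‖y - x‖) → y ∈ Ω) ∧ (ε * ‖y - x‖ < dot (y - x) n → y ∉ Ω)

/-- The outward unit normal field `ν` of `∂Ω` (it exists and is unique at each boundary point of a
`C²` domain). -/
noncomputable def outwardNormal (Ω : Set E3) (x : E3) : E3 :=
  Classical.epsilon (IsOutwardUnitNormal Ω x)

/-- The surface measure `dS` on `∂Ω`: two-dimensional Hausdorff measure, normalised so that it is
Lebesgue measure on planes. -/
noncomputable def surfaceMeasure (Ω : Set E3) : Measure E3 :=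
  (μHE[2] : Measure E3).restrict (frontier Ω)

/-! ### The Sobolev space `H¹`, traces, weak solutions and weak Cauchy data -/

/-- The partial derivative `∂ⱼ f` at `x`. -/
noncomputable def pderiv (j : Fin 3) (f : E3 → ℂ) (x : E3) : ℂ :=
  fderiv ℝ f x (EuclideanSpace.single j 1)

/-- The (complex-valued) test functions on `Ω`: smooth with compact support in `Ω`. -/
def IsTestFunction (Ω : Set E3) (φ : E3 → ℂ) : Prop :=
  ContDiff ℝ (⊤ : ℕ∞) φ ∧ HasCompactSupport φ ∧ tsupport φ ⊆ Ω

/-- `u ∈ H¹(Ω)` with weak gradient `G = (G₀, G₁, G₂)`. -/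
structure IsH1 (Ω : Set E3) (u : E3 → ℂ) (G : Fin 3 → E3 → ℂ) : Prop where
  memLp : MemLp u 2 (volume.restrict Ω)
  memLp_grad : ∀ j, MemLp (G j) 2 (volume.restrict Ω)
  weak_grad : ∀ φ, IsTestFunction Ω φ → ∀ j,
    ∫ x in Ω, u x * pderiv j φ x = -∫ x in Ω, G j x * φ x

/-- `g ∈ L²(∂Ω)` is the trace on `∂Ω` of the function `u ∈ H¹(Ω)` with weak gradient `G`: some
sequence of functions smooth up to the boundary converges to `u` in `H¹(Ω)`, and its restrictions
to `∂Ω` converge to `g` in `L²(∂Ω)`. -/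
def IsTrace (Ω : Set E3) (u : E3 → ℂ) (G : Fin 3 → E3 → ℂ) (g : E3 → ℂ) : Prop :=
  MemLp g 2 (surfaceMeasure Ω) ∧
  ∃ φ : ℕ → E3 → ℂ, (∀ m, ContDiff ℝ (⊤ : ℕ∞) (φ m)) ∧
    Tendsto (fun m => eLpNorm (φ m - u) 2 (volume.restrict Ω)) atTop (𝓝 0) ∧
    (∀ j, Tendsto (fun m => eLpNorm (pderiv j (φ m) - G j) 2 (volume.restrict Ω)) atTop (𝓝 0)) ∧
    Tendsto (fun m => eLpNorm (φ m - g) 2 (surfaceMeasure Ω)) atTop (𝓝 0)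

/-- `u ∈ H¹(Ω)`, with weak gradient `G`, is a weak solution of `Δu + k²u = F` in `Ω`. -/
structure IsWeakSolution (Ω : Set E3) (k : ℝ) (F u : E3 → ℂ) (G : Fin 3 → E3 → ℂ) : Prop where
  isH1 : IsH1 Ω u G
  weak_eq : ∀ φ, IsTestFunction Ω φ →
    ∫ x in Ω, (-(∑ j, G j x * pderiv j φ x) + (k : ℂ) ^ 2 * u x * φ x) = ∫ x in Ω, F x * φ x

/-- `(g, Λ)` is the Cauchy data on `∂Ω` of the weak solution `u` of `Δu + k²u = F`. The Dirichlet
datum `g` is the trace of `u`. The Neumann datum `Λ` is the weak normal derivative `∂u/∂ν`, the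
functional on boundary values of `H¹(Ω)` functions (that is, on `H^{1/2}(∂Ω)`) given by
`⟨∂u/∂ν, h⟩ = ∫_Ω (∇u · ∇w + (F - k²u) w) dx` for every `w ∈ H¹(Ω)` with trace `h`; here
`F - k²u` is the weak Laplacian of `u`. -/
structure IsCauchyData (Ω : Set E3) (k : ℝ) (F u : E3 → ℂ) (G : Fin 3 → E3 → ℂ)
    (g : E3 → ℂ) (Λ : (E3 → ℂ) → ℂ) : Prop where
  isTrace : IsTrace Ω u G g
  normal_deriv : ∀ (w : E3 → ℂ) (Gw : Fin 3 → E3 → ℂ) (h : E3 → ℂ),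
    IsH1 Ω w Gw → IsTrace Ω w Gw h →
      Λ h = ∫ x in Ω, ((∑ j, G j x * Gw j x) + (F x - (k : ℂ) ^ 2 * u x) * w x)

/-! ### The source domain -/

/-- The source term `F_{ρ,D}`, equal to `ρ` on `D` and to zero elsewhere. -/
noncomputable def source (ρ : E3 → ℂ) (D : Set E3) : E3 → ℂ := D.indicator ρ

/-- The support function `h_D(ω) = sup_{x ∈ D} x · ω`. -/
noncomputable def supportFn (D : Set E3) (ω : E3) : ℝ := sSup ((fun x => dot x ω) '' D)

/-- The set `H_ω(D)` of the points of the closure of `D` with `x · ω = h_D(ω)`. The direction `ω` is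
regular with respect to `D`, with `p(ω) = p`, when this set is `{p}`. -/
def supportFace (D : Set E3) (ω : E3) : Set E3 :=
  {x | x ∈ closure D ∧ dot x ω = supportFn D ω}

/-- `ω` is regular with respect to `D`, and `p = p(ω)` is the only point of `H_ω(D)`. -/
def IsRegularDirection (D : Set E3) (ω p : E3) : Prop := supportFace D ω = {p}

/-- `Q` is a possible base of a cone with apex `p` and height `δ` in direction `ω`: a nonempty bounded
relatively open subset of the plane `x · ω = p · ω - δ`. -/
def IsConeBase (p ω : E3) (δ : ℝ) (Q : Set E3) : Prop :=
  Q.Nonempty ∧ Bornology.IsBounded Q ∧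
    ∃ U : Set E3, IsOpen U ∧ Q = U ∩ {x | dot x ω = dot p ω - δ}

/-- The cone `D_{(p,ω)}(δ,Q)` with base `Q`, apex `p` and height `δ`. -/
def cone (p : E3) (δ : ℝ) (Q : Set E3) : Set E3 :=
  {x | ∃ s ∈ Ioo 0 δ, ∃ z ∈ Q, x = p + (s / δ) • (z - p)}

/-- `D` has a conical singularity from the regular direction `ω`, with `p = p(ω)`, realised by the
height `δ` and the base `Q`. -/
def HasConicalSingularity (D : Set E3) (ω p : E3) (δ : ℝ) (Q : Set E3) : Prop :=
  0 < δ ∧ IsConeBase p ω δ Q ∧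
    D ∩ {x | supportFn D ω - δ < dot x ω ∧ dot x ω < supportFn D ω} = cone p δ Q

/-- The section `Q_s` of the cone by the plane `x · ω = p · ω - s`. -/
def coneSection (p ω : E3) (δ : ℝ) (Q : Set E3) (s : ℝ) : Set E3 :=
  cone p δ Q ∩ {x | dot x ω = dot p ω - s}

/-- The constant `C_{(p,ω)}(δ,Q,ϑ) = 2 s ∫_{Q_s} {s - i (z - p) · ϑ}⁻³ dS_z`, computed with the
section at `s ∈ (0,δ)`. -/
noncomputable def coneConst (p ω : E3) (δ : ℝ) (Q : Set E3) (ϑ : E3) (s : ℝ) : ℂ :=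
  2 * (s : ℂ) * ∫ z in coneSection p ω δ Q s,
    1 / ((s : ℂ) - Complex.I * (dot (z - p) ϑ : ℂ)) ^ 3 ∂(μHE[2] : Measure E3)

/-! ### The indicator function -/

/-- `S(ω)`, the unit vectors perpendicular to `ω`. -/
def perpSphere (ω : E3) : Set E3 := {ϑ | ‖ϑ‖ = 1 ∧ dot ω ϑ = 0}

/-- `v(x) = exp (x · (τ ω + i √(τ² + k²) ϑ))`. -/
noncomputable def cgo (k : ℝ) (ω ϑ : E3) (τ : ℝ) (x : E3) : ℂ :=
  Complex.exp ((τ * dot x ω : ℝ) + Complex.I * (√(τ ^ 2 + k ^ 2) * dot x ϑ : ℝ))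

/-- `v_τ(x) = {x · (ω + i τ/√(τ² + k²) ϑ)} v(x)`, the derivative of `v` in `τ`. -/
noncomputable def cgoDeriv (k : ℝ) (ω ϑ : E3) (τ : ℝ) (x : E3) : ℂ :=
  ((dot x ω : ℂ) + Complex.I * (τ / √(τ ^ 2 + k ^ 2) * dot x ϑ : ℝ)) * cgo k ω ϑ τ x

/-- `∫_{∂Ω} (∂u/∂ν w - ∂w/∂ν u) dS` for a smooth function `w` and Cauchy data `(g, Λ)` of `u`, with
`∂u/∂ν` in the weak sense. -/
noncomputable def boundaryPairing (Ω : Set E3) (g : E3 → ℂ) (Λ : (E3 → ℂ) → ℂ) (w : E3 → ℂ) : ℂ :=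
  Λ w - ∫ x, fderiv ℝ w x (outwardNormal Ω x) * g x ∂(surfaceMeasure Ω)

/-- The indicator function `I_{ω,ϑ}(τ)`. -/
noncomputable def indicatorFn (Ω : Set E3) (k : ℝ) (g : E3 → ℂ) (Λ : (E3 → ℂ) → ℂ)
    (ω ϑ : E3) (τ : ℝ) : ℂ :=
  boundaryPairing Ω g Λ (cgo k ω ϑ τ)

/-- The derivative `I'_{ω,ϑ}(τ)` of the indicator function, as a boundary integral. -/
noncomputable def indicatorFnDeriv (Ω : Set E3) (k : ℝ) (g : E3 → ℂ) (Λ : (E3 → ℂ) → ℂ)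
    (ω ϑ : E3) (τ : ℝ) : ℂ :=
  boundaryPairing Ω g Λ (cgoDeriv k ω ϑ τ)

/-- The factor `τ³ e^{-τ h} e^{-i √(τ² + k²) p · ϑ}`. -/
noncomputable def scaling (k h : ℝ) (p ϑ : E3) (τ : ℝ) : ℂ :=
  (τ : ℂ) ^ 3 * Complex.exp (-(τ * h : ℝ)) *
    Complex.exp (-(Complex.I * (√(τ ^ 2 + k ^ 2) * dot p ϑ : ℝ)))

/-! Two facts carry the theorem: an exact identity turning boundary data into a volume integral, and
a Laplace-type expansion of that integral at the apex.

The identity. For a smooth `w` with `Δw + k²w = 0`, the weak normal derivative tested on `w` gives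
`∫ ∇u·∇w + (F - k²u)w`, while Green's formula for the trace of `u` gives `∫ ∇u·∇w + uΔw`. Their
difference is `∫ F w` (`IsBoundedC2Domain.boundaryPairing_eq`). Both `v` and `v_τ` are such
solutions because `ζ = τω + i√(τ²+k²)ϑ` satisfies `ζ·ζ = -k²`, and hence also `ζ·∂_τζ = 0`. So the
two indicators are the integrals of `ρ v` and `ρ v_τ` over `D`, and the statement about the
derivative is differentiation under the integral sign. Green's formula rests on the divergence
theorem with respect to Hausdorff measure; this follows from an area formula for graphs, a shear
that flattens each boundary chart, and a partition of unity.

The expansion. After normalisation the exponential has modulus `e^{-τd}`, where `d` is the depth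
below the supporting plane. Points of `D` at depth at least `ε` contribute exponentially little, and
the remaining ones form a truncated cone. There `x = p + s(y, -1)` gives volume element `s² ds dy`
and exponent `-sc(y)` with `Re c = τ`. Since `∫₀^∞ s² e^{-sc} ds = 2/c³`, the leading term is an
integral over the angular base, which homogeneity identifies with the cone constant
(`IsConeBase.coneConst_eq`). Replacing `ρ̃` by `ρ̃(p)` costs an extra factor `s^α` in the integrand,
that is `τ^{-α}` after integration. `exists_asymptotics` combines these estimates for a general
amplitude; the amplitudes `1` and `x·∂_τζ` give the two formulas. Only `‖ϑ‖ = 1` enters its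
constants, whence the uniformity. -/

/-! ### Orthonormal frames -/

/-- Euclidean two-space. -/
abbrev E2 : Type := EuclideanSpace ℝ (Fin 2)

/-- The identification of `ℝ² × ℝ`, with its Hilbert norm, with `ℝ³`. -/
noncomputable def stdFrame : WithLp 2 (E2 × ℝ) ≃ₗᵢ[ℝ] E3 :=
  LinearEquiv.isometryOfInner
    { toFun := fun q => !₂[q.fst 0, q.fst 1, q.snd]
      invFun := fun x => WithLp.toLp 2 (!₂[x 0, x 1], x 2)
      map_add' := fun a b => by ext i; fin_cases i <;> simp
      map_smul' := fun a b => by ext i; fin_cases i <;> simp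
      left_inv := fun q => by
        refine WithLp.ofLp_injective 2 (Prod.ext ?_ ?_)
        · ext i; fin_cases i <;> simp
        · simp
      right_inv := fun x => by ext i; fin_cases i <;> simp }
    (fun a b => by
      simp [WithLp.prod_inner_apply, PiLp.inner_apply, Fin.sum_univ_three, Fin.sum_univ_two])

/-- The coordinates `(y, t) ∈ ℝ² × ℝ` on `ℝ³` adapted to the rotation `R`. -/
noncomputable def frame (R : E3 ≃ₗᵢ[ℝ] E3) : (E2 × ℝ) ≃L[ℝ] E3 :=
  (WithLp.prodContinuousLinearEquiv 2 ℝ E2 ℝ).symm.trans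
    (stdFrame.trans R.symm).toContinuousLinearEquiv

theorem frame_apply (R : E3 ≃ₗᵢ[ℝ] E3) (q : E2 × ℝ) :
    frame R q = R.symm (stdFrame (WithLp.toLp 2 q)) := rfl

theorem inner_frame (R : E3 ≃ₗᵢ[ℝ] E3) (q q' : E2 × ℝ) :
    inner ℝ (frame R q) (frame R q') = inner ℝ q.1 q'.1 + q.2 * q'.2 := by
  rw [frame_apply, frame_apply, LinearIsometryEquiv.inner_map_map,
    LinearIsometryEquiv.inner_map_map, WithLp.prod_inner_apply]
  simp [mul_comm]

theorem norm_frame_sq (R : E3 ≃ₗᵢ[ℝ] E3) (q : E2 × ℝ) :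
    ‖frame R q‖ ^ 2 = ‖q.1‖ ^ 2 + q.2 ^ 2 := by
  rw [← real_inner_self_eq_norm_sq, inner_frame, real_inner_self_eq_norm_sq]; ring

theorem norm_fst_le_norm_frame (R : E3 ≃ₗᵢ[ℝ] E3) (q : E2 × ℝ) : ‖q.1‖ ≤ ‖frame R q‖ := by
  apply le_of_sq_le_sq _ (norm_nonneg _)
  rw [norm_frame_sq]; nlinarith [sq_nonneg q.2]

theorem norm_frame_snd (R : E3 ≃ₗᵢ[ℝ] E3) (t : ℝ) : ‖frame R (0, t)‖ = |t| := by
  rw [← sq_eq_sq₀ (norm_nonneg _) (abs_nonneg _), norm_frame_sq]; simp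

theorem frame_measurePreserving (R : E3 ≃ₗᵢ[ℝ] E3) : MeasurePreserving (frame R) :=
  ((stdFrame.trans R.symm).measurePreserving).comp (WithLp.volume_preserving_toLp E2 ℝ)

theorem rotate_frame (R : E3 ≃ₗᵢ[ℝ] E3) (q : E2 × ℝ) :
    R (frame R q) = !₂[q.1 0, q.1 1, q.2] := by
  rw [frame_apply, LinearIsometryEquiv.apply_symm_apply]; rfl

/-- The horizontal coordinates in the frame of `R`. -/
theorem frame_symm_fst (R : E3 ≃ₗᵢ[ℝ] E3) (x : E3) :
    ((frame R).symm x).1 = !₂[(R x) 0, (R x) 1] := by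
  obtain ⟨q, rfl⟩ := (frame R).surjective x
  rw [rotate_frame, ContinuousLinearEquiv.symm_apply_apply]
  ext i; fin_cases i <;> simp

theorem frame_symm_snd (R : E3 ≃ₗᵢ[ℝ] E3) (x : E3) : ((frame R).symm x).2 = (R x) 2 := by
  obtain ⟨q, rfl⟩ := (frame R).surjective x
  rw [rotate_frame, ContinuousLinearEquiv.symm_apply_apply]
  simp

/-! ### Surface measure on graphs -/

/-- The parametrization of the graph of `γ` in the frame of `R`. -/
noncomputable def graphMap (R : E3 ≃ₗᵢ[ℝ] E3) (γ : E2 → ℝ) (y : E2) : E3 := frame R (y, γ y)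

/-- The upward normal `(-∇γ, 1)` of the graph of `γ`, which is not normalised. -/
noncomputable def graphNormal (R : E3 ≃ₗᵢ[ℝ] E3) (γ : E2 → ℝ) (y : E2) : E3 :=
  frame R (-gradient γ y, 1)

theorem inner_graphNormal (R : E3 ≃ₗᵢ[ℝ] E3) (γ : E2 → ℝ) (y : E2) (q : E2 × ℝ) :
    inner ℝ (graphNormal R γ y) (frame R q) = q.2 - fderiv ℝ γ y q.1 := by
  rw [graphNormal, inner_frame, inner_neg_left, inner_gradient_left]; ring

theorem norm_graphNormal_sq (R : E3 ≃ₗᵢ[ℝ] E3) (γ : E2 → ℝ) (y : E2) :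
    ‖graphNormal R γ y‖ ^ 2 = 1 + ‖gradient γ y‖ ^ 2 := by
  rw [graphNormal, norm_frame_sq]; simp [add_comm]

theorem norm_graphNormal_pos (R : E3 ≃ₗᵢ[ℝ] E3) (γ : E2 → ℝ) (y : E2) :
    0 < ‖graphNormal R γ y‖ := by
  have := norm_graphNormal_sq R γ y
  by_contra h
  have h0 : ‖graphNormal R γ y‖ = 0 := le_antisymm (not_lt.1 h) (norm_nonneg _)
  rw [h0] at this; nlinarith [sq_nonneg ‖gradient γ y‖]

theorem continuous_graphNormal (R : E3 ≃ₗᵢ[ℝ] E3) {γ : E2 → ℝ} (hγ : ContDiff ℝ 1 γ) :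
    Continuous (graphNormal R γ) := by
  have : Continuous (gradient γ) :=
    (InnerProductSpace.toDual ℝ E2).symm.continuous.comp (hγ.continuous_fderiv one_ne_zero)
  unfold graphNormal
  fun_prop

theorem graphMap_injective (R : E3 ≃ₗᵢ[ℝ] E3) (γ : E2 → ℝ) :
    Function.Injective (graphMap R γ) := fun y y' h => by
  have := (frame R).injective h
  simpa using congrArg Prod.fst this

theorem continuous_graphMap (R : E3 ≃ₗᵢ[ℝ] E3) {γ : E2 → ℝ} (hγ : Continuous γ) :
    Continuous (graphMap R γ) := by
  unfold graphMap; fun_prop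

theorem graphMap_measurableEmbedding (R : E3 ≃ₗᵢ[ℝ] E3) {γ : E2 → ℝ} (hγ : Continuous γ) :
    MeasurableEmbedding (graphMap R γ) :=
  (continuous_graphMap R hγ).measurableEmbedding (graphMap_injective R γ)

/-- The tangent map `v ↦ (v, γ' v)` of the graph of `γ` at `y`. -/
noncomputable def graphTangent (R : E3 ≃ₗᵢ[ℝ] E3) (γ : E2 → ℝ) (y : E2) : E2 →ₗ[ℝ] E3 :=
  (frame R).toLinearMap ∘ₗ (LinearMap.id.prod (fderiv ℝ γ y).toLinearMap)

theorem graphTangent_apply (R : E3 ≃ₗᵢ[ℝ] E3) (γ : E2 → ℝ) (y v : E2) :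
    graphTangent R γ y v = frame R (v, fderiv ℝ γ y v) := rfl

/-- The Gram matrix of the tangent vectors is `I + ∇γ ∇γᵀ`, whose determinant is `1 + |∇γ|²`. -/
theorem normDet_graphTangent (R : E3 ≃ₗᵢ[ℝ] E3) (γ : E2 → ℝ) (y : E2) :
    (graphTangent R γ y).normDet = ‖graphNormal R γ y‖ := by
  rw [← sq_eq_sq₀ (LinearMap.normDet_nonneg _) (norm_nonneg _)]
  have h := (graphTangent R γ y).normDet_sq_eq_det_gram (EuclideanSpace.basisFun (Fin 2) ℝ)
  simp only [RCLike.ofReal_real_eq_id, id] at h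
  rw [h, norm_graphNormal_sq, Matrix.det_fin_two]
  simp only [Matrix.gram_apply, graphTangent_apply, inner_frame, ← inner_gradient_left]
  have hg (i : Fin 2) : (gradient γ y) i = fderiv ℝ γ y (EuclideanSpace.single i 1) := by
    rw [← inner_gradient_left, EuclideanSpace.inner_single_right]; simp
  simp [PiLp.inner_apply, EuclideanSpace.norm_sq_eq, Fin.sum_univ_two, hg]
  ring
theorem norm_le_norm_graphTangent (R : E3 ≃ₗᵢ[ℝ] E3) (γ : E2 → ℝ) (y v : E2) :
    ‖v‖ ≤ ‖graphTangent R γ y v‖ :=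
  norm_fst_le_norm_frame R (v, fderiv ℝ γ y v)

/-- Near each point the graph parametrization is uniformly close to its tangent map. -/
theorem graphMap_near_tangent (R : E3 ≃ₗᵢ[ℝ] E3) {γ : E2 → ℝ} (hγ : ContDiff ℝ 1 γ) (y₀ : E2)
    {ε : ℝ} (hε : 0 < ε) :
    ∃ r > 0, ∀ y ∈ Metric.closedBall y₀ r, ∀ y' ∈ Metric.closedBall y₀ r,
      ‖graphMap R γ y - graphMap R γ y' - graphTangent R γ y₀ (y - y')‖ ≤
        ε * ‖graphTangent R γ y₀ (y - y')‖ := by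
  have h := (hγ.contDiffAt (x := y₀)).hasStrictFDerivAt one_ne_zero
  have h' := h.isLittleO.def hε
  obtain ⟨r, hr, hr'⟩ := Metric.eventually_nhds_iff_ball.1 h'
  refine ⟨r / 2, by positivity, fun y hy y' hy' => ?_⟩
  have hm : (y, y') ∈ Metric.ball (y₀, y₀) r := by
    rw [Metric.mem_closedBall] at hy hy'
    rw [Metric.mem_ball, Prod.dist_eq]
    exact max_lt (by linarith) (by linarith)
  have h1 := hr' _ hm
  simp only at h1
  -- The horizontal parts cancel, so the error is the vertical linearisation error of `γ`.
  have h2 : graphMap R γ y - graphMap R γ y' - graphTangent R γ y₀ (y - y') =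
      frame R (0, γ y - γ y' - fderiv ℝ γ y₀ (y - y')) := by
    rw [graphMap, graphMap, graphTangent_apply, ← map_sub, ← map_sub]
    congr 1; ext <;> simp
  rw [h2, norm_frame_snd, ← Real.norm_eq_abs]
  exact h1.trans (mul_le_mul_of_nonneg_left (norm_le_norm_graphTangent R γ y₀ _) hε.le)

theorem LipschitzOnWith.euclideanHausdorffMeasure_image_le {X Y : Type*}
    [MetricSpace X] [MeasurableSpace X] [BorelSpace X] [MetricSpace Y] [MeasurableSpace Y]
    [BorelSpace Y] {K : ℝ≥0} {f : X → Y} {s : Set X} (h : LipschitzOnWith K f s) (d : ℕ) :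
    (μHE[d] : Measure Y) (f '' s) ≤ (K : ℝ≥0∞) ^ d * (μHE[d] : Measure X) s := by
  simp only [Measure.euclideanHausdorffMeasure_def, Measure.smul_apply, ENNReal.smul_def,
    smul_eq_mul]
  have := h.hausdorffMeasure_image_le (d := d) (by positivity)
  rw [ENNReal.rpow_natCast] at this
  calc _ ≤ _ := mul_le_mul_right this _
    _ = _ := by ring

/-- The measure `A ↦ μHE[2] (graph of γ over A)` on the plane. -/
noncomputable def graphMeasure (R : E3 ≃ₗᵢ[ℝ] E3) (γ : E2 → ℝ) : Measure E2 :=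
  (μHE[2] : Measure E3).comap (graphMap R γ)

theorem graphMeasure_apply (R : E3 ≃ₗᵢ[ℝ] E3) {γ : E2 → ℝ} (hγ : Continuous γ) (s : Set E2) :
    graphMeasure R γ s = (μHE[2] : Measure E3) (graphMap R γ '' s) :=
  (graphMap_measurableEmbedding R hγ).comap_apply _ s

theorem euclideanHausdorffMeasure_graphTangent_image (R : E3 ≃ₗᵢ[ℝ] E3) (γ : E2 → ℝ) (y : E2)
    (s : Set E2) : (μHE[2] : Measure E3) (graphTangent R γ y '' s) =
      ENNReal.ofReal ‖graphNormal R γ y‖ * volume s := by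
  have := (graphTangent R γ y).euclideanHausdorffMeasure_image_eq_normDet_mul_volume s
  rwa [normDet_graphTangent, finrank_euclideanSpace_fin] at this

/-- Both-sided comparison of the area of a graph with the area of its tangent plane. -/
theorem graphMeasure_near (R : E3 ≃ₗᵢ[ℝ] E3) {γ : E2 → ℝ} (hγ : ContDiff ℝ 1 γ) (y₀ : E2)
    {ε : ℝ≥0} (hε : 0 < ε) (hε1 : ε < 1) :
    ∃ r > 0, ∀ s ⊆ Metric.closedBall y₀ r,
      graphMeasure R γ s ≤
        ((1 + ε : ℝ≥0) : ℝ≥0∞) ^ 2 * (ENNReal.ofReal ‖graphNormal R γ y₀‖ * volume s) ∧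
      ENNReal.ofReal ‖graphNormal R γ y₀‖ * volume s ≤
        (((1 - ε)⁻¹ : ℝ≥0) : ℝ≥0∞) ^ 2 * graphMeasure R γ s := by
  obtain ⟨r, hr, h⟩ := graphMap_near_tangent R hγ y₀ (ε := ε) hε
  refine ⟨r, hr, fun s hs => ?_⟩
  set L := graphTangent R γ y₀
  set Φ := graphMap R γ
  -- Horizontal projection inverts both parametrizations. Hence `Φ ∘ π` carries the tangent plane to
  -- the graph and `L ∘ π` carries the graph back, with Lipschitz constants `1 + ε` and `(1 - ε)⁻¹`;
  -- these distort area by at most their squares.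
  let π : E3 → E2 := fun x => ((frame R).symm x).1
  have hπL (v : E2) : π (L v) = v := by simp [π, L, graphTangent_apply]
  have hπΦ (v : E2) : π (Φ v) = v := by simp [π, Φ, graphMap]
  rw [graphMeasure_apply R hγ.continuous, ← euclideanHausdorffMeasure_graphTangent_image]
  constructor
  · have hl : LipschitzOnWith (1 + ε) (Φ ∘ π) (L '' s) := by
      apply LipschitzOnWith.of_dist_le_mul
      rintro _ ⟨y, hy, rfl⟩ _ ⟨y', hy', rfl⟩
      rw [Function.comp, Function.comp, hπL, hπL, dist_eq_norm, dist_eq_norm, ← map_sub]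
      have h1 := h y (hs hy) y' (hs hy')
      have h2 := norm_le_norm_sub_add (Φ y - Φ y') (L (y - y'))
      push_cast
      linarith
    have := hl.euclideanHausdorffMeasure_image_le 2
    rwa [← image_comp, show (Φ ∘ π) ∘ L = Φ by ext1 v; simp [hπL]] at this
  · have hl : LipschitzOnWith (1 - ε)⁻¹ (L ∘ π) (Φ '' s) := by
      apply LipschitzOnWith.of_dist_le_mul
      rintro _ ⟨y, hy, rfl⟩ _ ⟨y', hy', rfl⟩
      rw [Function.comp, Function.comp, hπΦ, hπΦ, dist_eq_norm, dist_eq_norm, ← map_sub]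
      have h1 := h y (hs hy) y' (hs hy')
      have h2 := norm_le_norm_sub_add (L (y - y')) (Φ y - Φ y')
      rw [norm_sub_rev (L (y - y'))] at h2
      have h3 : (0 : ℝ) < 1 - ε := by simpa using hε1
      rw [NNReal.coe_inv, NNReal.coe_sub hε1.le, NNReal.coe_one, inv_mul_eq_div, le_div_iff₀ h3]
      linarith
    have := hl.euclideanHausdorffMeasure_image_le 2
    rwa [← image_comp, show (L ∘ π) ∘ Φ = L by ext1 v; simp [hπΦ]] at this

theorem graphMeasure_isLocallyFinite (R : E3 ≃ₗᵢ[ℝ] E3) {γ : E2 → ℝ} (hγ : ContDiff ℝ 1 γ) :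
    IsLocallyFiniteMeasure (graphMeasure R γ) := by
  refine ⟨fun y => ?_⟩
  obtain ⟨r, hr, h⟩ := graphMeasure_near R hγ y (ε := 1 / 2) (by norm_num)
    (NNReal.half_lt_self one_ne_zero)
  refine ⟨_, Metric.closedBall_mem_nhds y hr, (h _ subset_rfl).1.trans_lt ?_⟩
  refine ENNReal.mul_lt_top (ENNReal.pow_lt_top ENNReal.coe_lt_top)
    (ENNReal.mul_lt_top ENNReal.ofReal_lt_top measure_closedBall_lt_top)

theorem graphMeasure_absolutelyContinuous (R : E3 ≃ₗᵢ[ℝ] E3) {γ : E2 → ℝ}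
    (hγ : ContDiff ℝ 1 γ) : graphMeasure R γ ≪ volume := by
  intro s hs
  refine measure_null_of_locally_null s fun y _ => ?_
  obtain ⟨r, hr, h⟩ := graphMeasure_near R hγ y (ε := 1 / 2) (by norm_num)
    (NNReal.half_lt_self one_ne_zero)
  refine ⟨Metric.closedBall y r ∩ s,
    inter_mem (nhdsWithin_le_nhds (Metric.closedBall_mem_nhds y hr)) self_mem_nhdsWithin, ?_⟩
  have h1 := (h _ (inter_subset_left (t := s))).1
  rw [measure_mono_null inter_subset_right hs] at h1
  simpa using h1

/-- On small balls the ratio lies between `(1 - ε)² J` and `(1 + ε)² J` for every small `ε`, where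
`J` is the area factor of the tangent plane. -/
theorem tendsto_graphMeasure_div (R : E3 ≃ₗᵢ[ℝ] E3) {γ : E2 → ℝ} (hγ : ContDiff ℝ 1 γ) (y : E2) :
    Tendsto (fun r => graphMeasure R γ (Metric.closedBall y r) / volume (Metric.closedBall y r))
      (𝓝[>] 0) (𝓝 (ENNReal.ofReal ‖graphNormal R γ y‖)) := by
  set J := ENNReal.ofReal ‖graphNormal R γ y‖
  have hup : Tendsto (fun ε : ℝ≥0 => ((1 + ε : ℝ≥0) : ℝ≥0∞) ^ 2 * J) (𝓝[>] 0) (𝓝 J) := by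
    have : Continuous fun ε : ℝ≥0 => (1 + ε) ^ 2 * ‖graphNormal R γ y‖₊ := by fun_prop
    have h := (ENNReal.continuous_coe.comp this).tendsto 0
    simp only [Function.comp, ENNReal.coe_mul, ENNReal.coe_pow] at h
    refine (Tendsto.congr (fun ε => ?_) (h.mono_left nhdsWithin_le_nhds)).trans_eq ?_ <;>
      simp [J, ofReal_norm, enorm_eq_nnnorm]
  have hdn : Tendsto (fun ε : ℝ≥0 => (((1 - ε) : ℝ≥0) : ℝ≥0∞) ^ 2 * J) (𝓝[>] 0) (𝓝 J) := by
    have : Continuous fun ε : ℝ≥0 => (1 - ε) ^ 2 * ‖graphNormal R γ y‖₊ := by fun_prop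
    have h := (ENNReal.continuous_coe.comp this).tendsto 0
    simp only [Function.comp, ENNReal.coe_mul, ENNReal.coe_pow] at h
    refine (Tendsto.congr (fun ε => ?_) (h.mono_left nhdsWithin_le_nhds)).trans_eq ?_ <;>
      simp [J, ofReal_norm, enorm_eq_nnnorm]
  have hsmall : ∀ᶠ ε : ℝ≥0 in 𝓝[>] 0, 0 < ε ∧ ε < 1 := by
    filter_upwards [self_mem_nhdsWithin, nhdsWithin_le_nhds (Iio_mem_nhds one_pos)] with ε h1 h2
      using ⟨h1, h2⟩
  have hball {r : ℝ} (hr : 0 < r) : volume (Metric.closedBall y r) ≠ 0 :=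
    (Metric.measure_closedBall_pos _ _ hr).ne'
  have hball' (r : ℝ) : volume (Metric.closedBall y r) ≠ ∞ := measure_closedBall_lt_top.ne
  have key (ε : ℝ≥0) (h0 : 0 < ε) (h1 : ε < 1) : ∀ᶠ r in 𝓝[>] (0 : ℝ),
      graphMeasure R γ (Metric.closedBall y r) / volume (Metric.closedBall y r) ∈
        Icc (((1 - ε : ℝ≥0) : ℝ≥0∞) ^ 2 * J) (((1 + ε : ℝ≥0) : ℝ≥0∞) ^ 2 * J) := by
    obtain ⟨r, hr, h⟩ := graphMeasure_near R hγ y h0 h1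
    filter_upwards [Ioc_mem_nhdsGT hr] with t ht
    obtain ⟨hu, hl⟩ := h _ (Metric.closedBall_subset_closedBall ht.2)
    constructor
    · rw [ENNReal.le_div_iff_mul_le (Or.inl (hball ht.1)) (Or.inl (hball' t)), mul_assoc]
      have h4 : 1 - ε ≠ 0 := (tsub_pos_of_lt h1).ne'
      have h3 : ((1 - ε : ℝ≥0) : ℝ≥0∞) ≠ 0 := ENNReal.coe_ne_zero.2 h4
      rw [ENNReal.coe_inv h4] at hl
      calc _ ≤ _ := mul_le_mul_right hl _
        _ = _ := by
          rw [← mul_assoc, ← mul_pow, ENNReal.mul_inv_cancel h3 ENNReal.coe_ne_top, one_pow,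
            one_mul]
    · rw [ENNReal.div_le_iff (hball ht.1) (hball' t), mul_assoc]
      exact hu
  refine tendsto_order.2 ⟨fun a ha => ?_, fun a ha => ?_⟩
  · obtain ⟨ε, h1, h2, h3⟩ := ((hdn.eventually_const_lt ha).and hsmall).exists
    exact (key ε h2 h3).mono fun r hr => h1.trans_le hr.1
  · obtain ⟨ε, h1, h2, h3⟩ := ((hup.eventually_lt_const ha).and hsmall).exists
    exact (key ε h2 h3).mono fun r hr => hr.2.trans_lt h1

/-- The area formula for graphs. -/
theorem graphMeasure_eq_withDensity (R : E3 ≃ₗᵢ[ℝ] E3) {γ : E2 → ℝ} (hγ : ContDiff ℝ 1 γ) :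
    graphMeasure R γ = volume.withDensity fun y => ENNReal.ofReal ‖graphNormal R γ y‖ := by
  have := graphMeasure_isLocallyFinite R hγ
  rw [← Measure.withDensity_rnDeriv_eq _ _ (graphMeasure_absolutelyContinuous R hγ)]
  refine withDensity_congr_ae ?_
  -- Differentiation of measures: the density is almost everywhere the limit of ratios on shrinking
  -- balls, and that limit is known at every point.
  filter_upwards [Besicovitch.ae_tendsto_rnDeriv (graphMeasure R γ) volume] with y hy
  exact tendsto_nhds_unique hy (tendsto_graphMeasure_div R hγ y)

theorem restrict_range_graphMap (R : E3 ≃ₗᵢ[ℝ] E3) {γ : E2 → ℝ} (hγ : ContDiff ℝ 1 γ) :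
    (μHE[2] : Measure E3).restrict (range (graphMap R γ)) =
      (volume.withDensity fun y => ENNReal.ofReal ‖graphNormal R γ y‖).map (graphMap R γ) := by
  rw [← graphMeasure_eq_withDensity R hγ, graphMeasure,
    (graphMap_measurableEmbedding R hγ.continuous).map_comap]

theorem setIntegral_range_graphMap (R : E3 ≃ₗᵢ[ℝ] E3) {γ : E2 → ℝ} (hγ : ContDiff ℝ 1 γ)
    (f : E3 → ℂ) :
    ∫ x in range (graphMap R γ), f x ∂(μHE[2] : Measure E3) =
      ∫ y, ‖graphNormal R γ y‖ • f (graphMap R γ y) := by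
  rw [restrict_range_graphMap R hγ,
    (graphMap_measurableEmbedding R hγ.continuous).integral_map,
    integral_withDensity_eq_integral_toReal_smul
      (by have := continuous_graphNormal R hγ; fun_prop) (by simp)]
  simp
/-! ### The divergence theorem for subgraphs -/

/-- The region strictly below the graph of `γ` in the frame of `R`. -/
def subgraph (R : E3 ≃ₗᵢ[ℝ] E3) (γ : E2 → ℝ) : Set E3 :=
  {x | ((frame R).symm x).2 < γ ((frame R).symm x).1}

/-- The coordinates `(y, t) ↦ (y, t + γ y)` that flatten the graph of `γ`. -/
noncomputable def flatten (R : E3 ≃ₗᵢ[ℝ] E3) {γ : E2 → ℝ} (hγ : Continuous γ) :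
    (E2 × ℝ) ≃ₜ E3 :=
  (Homeomorph.mk
    { toFun := fun q => (q.1, q.2 + γ q.1)
      invFun := fun q => (q.1, q.2 - γ q.1)
      left_inv := fun q => by simp
      right_inv := fun q => by simp } (by fun_prop) (by fun_prop)).trans
    (frame R).toHomeomorph

theorem flatten_apply (R : E3 ≃ₗᵢ[ℝ] E3) {γ : E2 → ℝ} (hγ : Continuous γ) (q : E2 × ℝ) :
    flatten R hγ q = frame R (q.1, q.2 + γ q.1) := rfl

/-- A shear translates each vertical line, so it preserves volume without any differentiability of
`γ`. -/
theorem flatten_measurePreserving (R : E3 ≃ₗᵢ[ℝ] E3) {γ : E2 → ℝ} (hγ : Continuous γ) :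
    MeasurePreserving (flatten R hγ) := by
  refine (frame_measurePreserving R).comp ?_
  exact MeasurePreserving.skew_product (g := fun y t => t + γ y) (MeasurePreserving.id volume)
    (by fun_prop) (ae_of_all _ fun y => (measurePreserving_add_right volume (γ y)).map_eq)

theorem flatten_preimage_subgraph (R : E3 ≃ₗᵢ[ℝ] E3) {γ : E2 → ℝ} (hγ : Continuous γ) :
    flatten R hγ ⁻¹' subgraph R γ = univ ×ˢ Iio 0 := by
  ext q
  simp [flatten_apply, subgraph]

/-- Integration by parts against the constant function `1`. -/
theorem integral_fderiv_eq_zero {E : Type*} [NormedAddCommGroup E] [NormedSpace ℝ E]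
    [FiniteDimensional ℝ E] [MeasurableSpace E] [BorelSpace E] (μ : Measure E)
    [μ.IsAddHaarMeasure] {f : E → ℂ} (hf : ContDiff ℝ 1 f) (hc : HasCompactSupport f) (v : E) :
    ∫ x, fderiv ℝ f x v ∂μ = 0 := by
  have h1 : Continuous fun x => fderiv ℝ f x v :=
    (hf.continuous_fderiv one_ne_zero).clm_apply continuous_const
  have h2 : HasCompactSupport fun x => fderiv ℝ f x v := hc.fderiv_apply (𝕜 := ℝ) v
  have := integral_mul_fderiv_eq_neg_fderiv_mul_of_integrable (𝕜 := ℂ) (μ := μ)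
    (f := fun _ : E => (1 : ℂ)) (g := f) (v := v) (by simp)
    (by simpa using h1.integrable_of_hasCompactSupport h2)
    (by simpa using hf.continuous.integrable_of_hasCompactSupport hc)
    (fun _ _ => by fun_prop) (fun x _ => (hf.differentiable one_ne_zero) x)
  simpa using this

theorem integral_Iio_deriv_eq {h : ℝ → ℂ} (hd : ContDiff ℝ 1 h) (hc : HasCompactSupport h) (a : ℝ) :
    ∫ t in Iio a, deriv h t = h a := by
  have := integral_Iic_of_hasDerivAt_of_tendsto (f := h) (f' := deriv h) (a := a) (m := 0)
    hd.continuous.continuousWithinAt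
    (fun x _ => ((hd.differentiable one_ne_zero) x).hasDerivAt)
    ((hd.continuous_deriv le_rfl).integrable_of_hasCompactSupport hc.deriv).integrableOn
    (hc.is_zero_at_infty.mono_left _root_.atBot_le_cocompact)
  rw [← integral_Iic_eq_integral_Iio, this, sub_zero]

/-- The divergence theorem for the region below a graph and compactly supported functions. -/
theorem setIntegral_subgraph_fderiv (R : E3 ≃ₗᵢ[ℝ] E3) {γ : E2 → ℝ} (hγ : ContDiff ℝ 1 γ)
    {f : E3 → ℂ} (hf : ContDiff ℝ 1 f) (hc : HasCompactSupport f) (v : E3) :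
    ∫ x in subgraph R γ, fderiv ℝ f x v =
      ∫ y, (inner ℝ (graphNormal R γ y) v) • f (graphMap R γ y) := by
  obtain ⟨⟨a, b⟩, rfl⟩ := (frame R).surjective v
  set Ψ := flatten R hγ.continuous
  set G : E2 × ℝ → ℂ := f ∘ Ψ
  have hΨ : ContDiff ℝ 1 Ψ := by
    have : ContDiff ℝ 1 fun q : E2 × ℝ => frame R (q.1, q.2 + γ q.1) := by fun_prop
    exact this
  have hG : ContDiff ℝ 1 G := hf.comp hΨ
  have hGc : HasCompactSupport G := hc.comp_homeomorph Ψ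
  have hGd : Continuous (fderiv ℝ G) := hG.continuous_fderiv one_ne_zero
  have hΨ' (q w : E2 × ℝ) : fderiv ℝ Ψ q w = frame R (w.1, w.2 + fderiv ℝ γ q.1 w.1) := by
    have hγ' : HasFDerivAt (fun q : E2 × ℝ => γ q.1)
        ((fderiv ℝ γ q.1).comp (ContinuousLinearMap.fst ℝ E2 ℝ)) q :=
      ((hγ.differentiable one_ne_zero) q.1).hasFDerivAt.comp q hasFDerivAt_fst
    have := (frame R).toContinuousLinearMap.hasFDerivAt.comp q
      (hasFDerivAt_fst.prodMk (hasFDerivAt_snd.add hγ'))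
    have h2 : fderiv ℝ Ψ q = _ := HasFDerivAt.fderiv this
    rw [h2]; rfl
  have hGf (q w : E2 × ℝ) : fderiv ℝ G q w =
      fderiv ℝ f (Ψ q) (frame R (w.1, w.2 + fderiv ℝ γ q.1 w.1)) := by
    rw [fderiv_comp q ((hf.differentiable one_ne_zero) _) ((hΨ.differentiable one_ne_zero) _),
      ContinuousLinearMap.comp_apply, hΨ']
  -- In flattened coordinates `v` becomes the horizontal vector `(a, 0)` plus a vertical multiple.
  -- The multiplier `b - γ' a` is the inner product of `v` with the unnormalised normal and does not
  -- depend on the vertical coordinate.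
  have hsplit (q : E2 × ℝ) : fderiv ℝ f (Ψ q) (frame R (a, b)) =
      fderiv ℝ G q (a, 0) + (b - fderiv ℝ γ q.1 a) • fderiv ℝ G q (0, 1) := by
    rw [hGf, hGf, ← map_smul, ← map_add, ← map_smul, ← map_add]
    simp
  have hmeas : MeasurableEmbedding Ψ := Ψ.measurableEmbedding
  rw [← (flatten_measurePreserving R hγ.continuous).setIntegral_preimage_emb hmeas,
    flatten_preimage_subgraph]
  simp_rw [show ∀ q, fderiv ℝ f (flatten R hγ.continuous q) (frame R (a, b)) = _ from hsplit]
  have hc1 : Continuous fun q => fderiv ℝ G q (a, 0) := hGd.clm_apply continuous_const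
  have hc2 : Continuous fun q => fderiv ℝ G q (0, 1) := hGd.clm_apply continuous_const
  have hs1 : HasCompactSupport fun q => fderiv ℝ G q (a, 0) := hGc.fderiv_apply (𝕜 := ℝ) _
  have hs2 : HasCompactSupport fun q => fderiv ℝ G q (0, 1) := hGc.fderiv_apply (𝕜 := ℝ) _
  have hc3 : Continuous fun q : E2 × ℝ => b - fderiv ℝ γ q.1 a := by
    have := hγ.continuous_fderiv one_ne_zero
    fun_prop
  have hi1 : Integrable fun q => fderiv ℝ G q (a, 0) := hc1.integrable_of_hasCompactSupport hs1
  have hi2 : Integrable fun q : E2 × ℝ => (b - fderiv ℝ γ q.1 a) • fderiv ℝ G q (0, 1) :=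
    (hc3.smul hc2).integrable_of_hasCompactSupport (hs2.smul_left)
  rw [integral_add hi1.integrableOn hi2.integrableOn]
  -- Each horizontal slice is a whole plane, so the horizontal derivative integrates to zero; only
  -- the vertical one produces a boundary term.
  have e1 : ∫ q in univ ×ˢ Iio (0 : ℝ), fderiv ℝ G q (a, 0) = 0 := by
    rw [Measure.volume_eq_prod, ← Measure.prod_restrict, integral_prod_symm]
    · refine integral_eq_zero_of_ae (ae_of_all _ fun t => ?_)
      have hcomp : ContDiff ℝ 1 fun y => G (y, t) := hG.comp (by fun_prop)
      have hcs : HasCompactSupport fun y => G (y, t) :=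
        hGc.comp_isClosedEmbedding (.of_continuous_injective_isClosedMap (by fun_prop)
          (fun _ _ h => congrArg Prod.fst h) (isClosedMap_prodMk_right t))
      have h0 := integral_fderiv_eq_zero volume hcomp hcs a
      rw [Measure.restrict_univ]
      refine Eq.trans ?_ h0
      refine integral_congr_ae (ae_of_all _ fun y => ?_)
      have : HasFDerivAt (fun y : E2 => (y, t)) (ContinuousLinearMap.inl ℝ E2 ℝ) y :=
        hasFDerivAt_prodMk_left y t
      have h2 := ((hG.differentiable one_ne_zero) (y, t)).hasFDerivAt.comp y this
      have h3 : fderiv ℝ (fun y => G (y, t)) y = _ := HasFDerivAt.fderiv h2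
      simp [h3]
    · rw [Measure.prod_restrict]; exact hi1.integrableOn
  rw [e1, zero_add, Measure.volume_eq_prod, ← Measure.prod_restrict, integral_prod]
  · rw [Measure.restrict_univ]
    refine integral_congr_ae (ae_of_all _ fun y => ?_)
    simp only
    rw [show (∫ t in Iio (0 : ℝ), (b - fderiv ℝ γ (y, t).1 a) • fderiv ℝ G (y, t) (0, 1)) = _
      from integral_smul (b - fderiv ℝ γ y a) _, inner_graphNormal]
    congr 1
    have hcomp : ContDiff ℝ 1 fun t => G (y, t) := hG.comp (by fun_prop)
    have hcs : HasCompactSupport fun t => G (y, t) :=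
      hGc.comp_isClosedEmbedding (.of_continuous_injective_isClosedMap (by fun_prop)
        (fun _ _ h => congrArg Prod.snd h) (isClosedMap_prodMk_left y))
    have h0 := integral_Iio_deriv_eq hcomp hcs 0
    have h1 : G (y, 0) = f (graphMap R γ y) := by
      simp [G, Ψ, flatten_apply, graphMap]
    rw [← h1, ← h0]
    refine integral_congr_ae (ae_of_all _ fun t => ?_)
    have : HasFDerivAt (fun t : ℝ => (y, t)) (ContinuousLinearMap.inr ℝ E2 ℝ) t :=
      hasFDerivAt_prodMk_right y t
    have h2 := ((hG.differentiable one_ne_zero) (y, t)).hasFDerivAt.comp_hasDerivAt t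
      this.hasDerivAt
    have h3 : deriv (fun t => G (y, t)) t = _ := HasDerivAt.deriv h2
    simp [h3]
  · rw [Measure.prod_restrict]; exact hi2.integrableOn
/-! ### Boundary charts and the outward normal -/

theorem continuous_frame_symm (R : E3 ≃ₗᵢ[ℝ] E3) : Continuous (frame R).symm :=
  (frame R).symm.continuous

theorem range_graphMap (R : E3 ≃ₗᵢ[ℝ] E3) (γ : E2 → ℝ) :
    range (graphMap R γ) = {x | ((frame R).symm x).2 = γ ((frame R).symm x).1} := by
  ext x
  constructor
  · rintro ⟨y, rfl⟩; simp [graphMap]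
  · intro hx
    refine ⟨((frame R).symm x).1, ?_⟩
    rw [graphMap, ← (hx : _ = _)]; simp

theorem frontier_subgraph (R : E3 ≃ₗᵢ[ℝ] E3) {γ : E2 → ℝ} (hγ : Continuous γ) :
    frontier (subgraph R γ) = range (graphMap R γ) := by
  apply (flatten R hγ).surjective.preimage_injective
  rw [(flatten R hγ).preimage_frontier, flatten_preimage_subgraph, frontier_univ_prod_eq,
    frontier_Iio, range_graphMap]
  ext q
  simp [flatten_apply]

/-- The open set `Ω` lies below the graph of `γ` in the frame of `R` inside `V`. -/
structure IsGraphChart (Ω V : Set E3) (R : E3 ≃ₗᵢ[ℝ] E3) (γ : E2 → ℝ) : Prop where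
  isOpen : IsOpen V
  contDiff : ContDiff ℝ 1 γ
  mem_iff : ∀ y ∈ V, (y ∈ Ω ↔ y ∈ subgraph R γ)

theorem IsBoundedC2Domain.exists_chart {Ω : Set E3} (hΩ : IsBoundedC2Domain Ω) {x : E3}
    (hx : x ∈ frontier Ω) :
    ∃ (r : ℝ) (R : E3 ≃ₗᵢ[ℝ] E3) (γ : E2 → ℝ), 0 < r ∧ IsGraphChart Ω (Metric.ball x r) R γ := by
  obtain ⟨r, R, γ, hr, hγ, h⟩ := hΩ.boundary x hx
  refine ⟨r, R, γ, hr, Metric.isOpen_ball, hγ.of_le one_le_two, fun y hy => ?_⟩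
  rw [h y hy, subgraph, mem_ofPred_eq, frame_symm_fst, frame_symm_snd]

namespace IsGraphChart

variable {Ω V : Set E3} {R : E3 ≃ₗᵢ[ℝ] E3} {γ : E2 → ℝ}

theorem inter_eq (h : IsGraphChart Ω V R γ) : Ω ∩ V = subgraph R γ ∩ V := by
  ext y
  exact and_congr_left (h.mem_iff y)

theorem frontier_inter_eq (h : IsGraphChart Ω V R γ) :
    frontier Ω ∩ V = range (graphMap R γ) ∩ V := by
  rw [← frontier_inter_open_inter h.isOpen, h.inter_eq, frontier_inter_open_inter h.isOpen,
    frontier_subgraph R h.contDiff.continuous]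

/-- The height of a nearby point above the graph differs from its displacement paired with the
unnormalised normal by the Taylor error of `γ`, which is at most `ε` times the horizontal distance.
-/
theorem isOutwardUnitNormal (h : IsGraphChart Ω V R γ) {y : E2} (hy : graphMap R γ y ∈ V) :
    IsOutwardUnitNormal Ω (graphMap R γ y) (‖graphNormal R γ y‖⁻¹ • graphNormal R γ y) := by
  have hN := norm_graphNormal_pos R γ y
  have hN1 : 1 ≤ ‖graphNormal R γ y‖ := by
    rw [← one_le_sq_iff₀ hN.le, norm_graphNormal_sq]
    linarith [sq_nonneg ‖gradient γ y‖]
  refine ⟨by rw [norm_smul, norm_inv, norm_norm, inv_mul_cancel₀ hN.ne'], fun ε hε => ?_⟩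
  have hd := ((h.contDiff.differentiable one_ne_zero) y).hasFDerivAt.isLittleO.def hε
  have hcont : Tendsto (fun z => ((frame R).symm z).1) (𝓝 (graphMap R γ y)) (𝓝 y) := by
    have : Continuous fun z => ((frame R).symm z).1 :=
      continuous_fst.comp (continuous_frame_symm R)
    simpa [graphMap] using this.tendsto (graphMap R γ y)
  filter_upwards [h.isOpen.mem_nhds hy, hcont.eventually hd] with z hz hzd
  obtain ⟨⟨a, b⟩, rfl⟩ := (frame R).surjective z
  simp only [ContinuousLinearEquiv.symm_apply_apply] at hzd
  rw [h.mem_iff _ hz, subgraph, mem_ofPred_eq, ContinuousLinearEquiv.symm_apply_apply]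
  have hsub : frame R (a, b) - graphMap R γ y = frame R (a - y, b - γ y) := by
    rw [graphMap, ← map_sub]; rfl
  have hfst := norm_fst_le_norm_frame R (a - y, b - γ y)
  simp only at hfst
  rw [hsub, dot, inner_smul_right, real_inner_comm, inner_graphNormal]
  set ℓ := ‖frame R (a - y, b - γ y)‖
  rw [Real.norm_eq_abs, abs_le] at hzd
  -- The unnormalised normal has length at least one, so dividing by it does not spoil the margin
  -- `ε`.
  have h1 : ε * ‖a - y‖ ≤ ‖graphNormal R γ y‖ * (ε * ℓ) := by
    calc ε * ‖a - y‖ ≤ ε * ℓ := by gcongr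
      _ ≤ _ := le_mul_of_one_le_left (by positivity) hN1
  simp only
  constructor
  · intro hlt
    rw [inv_mul_eq_div, div_lt_iff₀ hN] at hlt
    linarith [hzd.1]
  · intro hlt
    rw [inv_mul_eq_div, lt_div_iff₀ hN] at hlt
    linarith [hzd.2]

end IsGraphChart

/-- If `n ≠ n'`, a short move along `n' - n` goes strictly inward for `n` and strictly outward for
`n'`, so the endpoint would lie both inside and outside `Ω`. -/
theorem IsOutwardUnitNormal.unique {Ω : Set E3} {x n n' : E3} (h : IsOutwardUnitNormal Ω x n)
    (h' : IsOutwardUnitNormal Ω x n') : n = n' := by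
  by_contra hne
  have h1 : inner ℝ n n' < 1 := by
    exact (inner_lt_one_iff_real_of_norm_eq_one h.1 h'.1).2 hne
  set c := 1 - inner ℝ n n' with hc
  have hcpos : 0 < c := by linarith
  set d := n' - n
  have hdn : inner ℝ d n = -c := by
    simp only [d, inner_sub_left, real_inner_self_eq_norm_sq, h.1, hc]
    rw [real_inner_comm]; ring
  have hdn' : inner ℝ d n' = c := by
    simp only [d, inner_sub_left, real_inner_self_eq_norm_sq, h'.1, hc]; ring
  have hd : 0 < ‖d‖ := norm_pos_iff.2 (sub_ne_zero.2 (Ne.symm hne))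
  -- This tolerance makes the margin after a step `t • d` equal to `t * c / 2`, half of the normal
  -- displacement `t * c`.
  have hε : 0 < c / (2 * ‖d‖) := by positivity
  have ht : Tendsto (fun t : ℝ => x + t • d) (𝓝[>] 0) (𝓝 x) := by
    have : Continuous fun t : ℝ => x + t • d := by fun_prop
    simpa using (this.tendsto 0).mono_left nhdsWithin_le_nhds
  obtain ⟨t, ⟨ha, hb⟩, ht0⟩ := (((ht.eventually (h.2 _ hε)).and (ht.eventually (h'.2 _ hε))).and
    self_mem_nhdsWithin).exists
  have ht0 : 0 < t := ht0
  have hlen : c / (2 * ‖d‖) * ‖x + t • d - x‖ = t * c / 2 := by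
    rw [add_sub_cancel_left, norm_smul, Real.norm_of_nonneg ht0.le]
    field_simp
  rw [hlen, dot, add_sub_cancel_left, inner_smul_left] at ha hb
  simp only [conj_trivial, hdn, hdn'] at ha hb
  have : 0 < t * c := by positivity
  exact hb.2 (by linarith) (ha.1 (by linarith))

namespace IsGraphChart

variable {Ω V : Set E3} {R : E3 ≃ₗᵢ[ℝ] E3} {γ : E2 → ℝ}

/-- The field is defined by an arbitrary choice; existence and uniqueness of the outward normal
force it to agree with the chart formula. -/
theorem outwardNormal_eq (h : IsGraphChart Ω V R γ) {y : E2} (hy : graphMap R γ y ∈ V) :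
    outwardNormal Ω (graphMap R γ y) = ‖graphNormal R γ y‖⁻¹ • graphNormal R γ y :=
  (Classical.epsilon_spec (p := IsOutwardUnitNormal Ω (graphMap R γ y))
    ⟨_, h.isOutwardUnitNormal hy⟩).unique (h.isOutwardUnitNormal hy)

theorem continuousOn_outwardNormal (h : IsGraphChart Ω V R γ) :
    ContinuousOn (outwardNormal Ω) (frontier Ω ∩ V) := by
  have hc : Continuous fun z => ‖graphNormal R γ ((frame R).symm z).1‖⁻¹ •
      graphNormal R γ ((frame R).symm z).1 := by
    have h1 := (continuous_graphNormal R h.contDiff).comp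
      (continuous_fst.comp (continuous_frame_symm R))
    exact (h1.norm.inv₀ fun z => (norm_graphNormal_pos R γ _).ne').smul h1
  refine hc.continuousOn.congr fun z hz => ?_
  have hzV := hz.2
  rw [h.frontier_inter_eq] at hz
  obtain ⟨⟨y, rfl⟩, -⟩ := hz
  rw [h.outwardNormal_eq hzV]
  simp [graphMap]

/-- The divergence theorem for functions supported in a boundary chart. -/
theorem setIntegral_fderiv (h : IsGraphChart Ω V R γ) {f : E3 → ℂ} (hf : ContDiff ℝ 1 f)
    (hc : HasCompactSupport f) (hV : tsupport f ⊆ V) (v : E3) :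
    ∫ x in Ω, fderiv ℝ f x v =
      ∫ x, (inner ℝ (outwardNormal Ω x) v) • f x ∂(surfaceMeasure Ω) := by
  have hVm := h.isOpen.measurableSet
  have hs1 : Function.support (fun x => fderiv ℝ f x v) ⊆ V := fun x hx => by
    refine hV (support_fderiv_subset ℝ (f := f) fun h0 => hx ?_)
    simp only; rw [h0]; rfl
  have hs2 : Function.support (fun x => (inner ℝ (outwardNormal Ω x) v) • f x) ⊆ V := fun x hx =>
    hV (subset_tsupport f fun h0 => hx (by simp only; rw [h0, smul_zero]))
  have restr (μ : Measure E3) (A : Set E3) (F : E3 → ℂ) (hF : Function.support F ⊆ V) :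
      ∫ x in A, F x ∂μ = ∫ x in A ∩ V, F x ∂μ := by
    rw [inter_comm, ← Measure.restrict_restrict hVm]
    exact (setIntegral_eq_integral_of_forall_compl_eq_zero
      fun x hx => Function.notMem_support.1 fun h' => hx (hF h')).symm
  -- Both integrands vanish off `V`, where `Ω` and the subgraph, and likewise their frontiers,
  -- coincide. The area density then cancels the normalisation of the normal.
  rw [restr _ _ _ hs1, h.inter_eq, ← restr _ _ _ hs1,
    setIntegral_subgraph_fderiv R h.contDiff hf hc, surfaceMeasure, restr _ _ _ hs2,
    h.frontier_inter_eq, ← restr _ _ _ hs2, setIntegral_range_graphMap R h.contDiff]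
  refine integral_congr_ae (ae_of_all _ fun y => ?_)
  simp only
  by_cases hy : graphMap R γ y ∈ V
  · rw [h.outwardNormal_eq hy, inner_smul_left, smul_smul, conj_trivial, ← mul_assoc,
      mul_inv_cancel₀ (norm_graphNormal_pos R γ y).ne', one_mul]
  · have : f (graphMap R γ y) = 0 :=
      Function.notMem_support.1 fun h' => hy (hV (subset_tsupport f h'))
    rw [this]; simp

theorem exists_nhds_measure_lt_top (h : IsGraphChart Ω V R γ) {x : E3} (hx : x ∈ V)
    (hxΩ : x ∈ frontier Ω) :
    ∃ s ∈ 𝓝[frontier Ω] x, (μHE[2] : Measure E3) s < ∞ := by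
  have hx' : x ∈ range (graphMap R γ) ∩ V := h.frontier_inter_eq ▸ ⟨hxΩ, hx⟩
  obtain ⟨⟨y, rfl⟩, -⟩ := hx'
  have := graphMeasure_isLocallyFinite R h.contDiff
  obtain ⟨s, hs, hsf⟩ := (graphMeasure R γ).finiteAt_nhds y
  have hcont : Continuous fun z => ((frame R).symm z).1 :=
    continuous_fst.comp (continuous_frame_symm R)
  have hpre : (fun z => ((frame R).symm z).1) ⁻¹' s ∈ 𝓝 (graphMap R γ y) :=
    hcont.continuousAt.preimage_mem_nhds (by simpa [graphMap] using hs)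
  refine ⟨frontier Ω ∩ (V ∩ (fun z => ((frame R).symm z).1) ⁻¹' s),
    inter_mem_nhdsWithin _ (inter_mem (h.isOpen.mem_nhds hx) hpre), ?_⟩
  rw [graphMeasure_apply R h.contDiff.continuous] at hsf
  refine (measure_mono ?_).trans_lt hsf
  rintro z ⟨hz1, hz2, hz3⟩
  have : z ∈ range (graphMap R γ) ∩ V := h.frontier_inter_eq ▸ ⟨hz1, hz2⟩
  obtain ⟨⟨y', rfl⟩, -⟩ := this
  exact mem_image_of_mem _ (by simpa [graphMap] using hz3)

end IsGraphChart

namespace IsBoundedC2Domain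

variable {Ω : Set E3}

theorem isCompact_frontier (hΩ : IsBoundedC2Domain Ω) : IsCompact (frontier Ω) :=
  hΩ.isBounded.isCompact_closure.of_isClosed_subset isClosed_frontier frontier_subset_closure

/-- The area is locally finite in each chart, and the boundary is compact. -/
theorem isFiniteMeasure_surfaceMeasure (hΩ : IsBoundedC2Domain Ω) :
    IsFiniteMeasure (surfaceMeasure Ω) := by
  refine ⟨?_⟩
  rw [surfaceMeasure, Measure.restrict_apply_univ]
  refine hΩ.isCompact_frontier.measure_lt_top_of_nhdsWithin fun x hx => ?_
  obtain ⟨r, R, γ, hr, h⟩ := hΩ.exists_chart hx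
  exact h.exists_nhds_measure_lt_top (Metric.mem_ball_self hr) hx

theorem isFiniteMeasure_volume (hΩ : IsBoundedC2Domain Ω) :
    IsFiniteMeasure (volume.restrict Ω) :=
  ⟨by rw [Measure.restrict_apply_univ]; exact hΩ.isBounded.measure_lt_top⟩

theorem continuousOn_outwardNormal (hΩ : IsBoundedC2Domain Ω) :
    ContinuousOn (outwardNormal Ω) (frontier Ω) := by
  intro x hx
  obtain ⟨r, R, γ, hr, h⟩ := hΩ.exists_chart hx
  have := h.continuousOn_outwardNormal x ⟨hx, Metric.mem_ball_self hr⟩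
  rwa [continuousWithinAt_inter (Metric.ball_mem_nhds x hr)] at this

theorem integrable_surfaceMeasure (hΩ : IsBoundedC2Domain Ω) {f : E3 → ℂ}
    (hf : ContinuousOn f (frontier Ω)) : Integrable f (surfaceMeasure Ω) := by
  have := hΩ.isFiniteMeasure_surfaceMeasure
  obtain ⟨C, hC⟩ := hΩ.isCompact_frontier.exists_bound_of_continuousOn hf
  refine Integrable.of_bound (hf.aestronglyMeasurable isClosed_frontier.measurableSet) C ?_
  exact ae_restrict_of_forall_mem isClosed_frontier.measurableSet hC

theorem continuousOn_inner_outwardNormal (hΩ : IsBoundedC2Domain Ω) (v : E3) :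
    ContinuousOn (fun x => inner ℝ (outwardNormal Ω x) v) (frontier Ω) :=
  hΩ.continuousOn_outwardNormal.inner continuousOn_const

/-- The divergence theorem on a bounded `C²` domain. -/
theorem setIntegral_fderiv (hΩ : IsBoundedC2Domain Ω) {f : E3 → ℂ} (hf : ContDiff ℝ 1 f) (v : E3) :
    ∫ x in Ω, fderiv ℝ f x v =
      ∫ x, (inner ℝ (outwardNormal Ω x) v) • f x ∂(surfaceMeasure Ω) := by
  classical
  have hfin := hΩ.isFiniteMeasure_volume
  -- Every point receives an open set on which the theorem is known for functions supported there.
  -- Off the frontier `V = Ω` serves, also for exterior points, which need not be covered.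
  have hopen : ∀ x : E3, ∃ V : Set E3, IsOpen V ∧ (x ∈ closure Ω → x ∈ V) ∧
      ∀ g : E3 → ℂ, ContDiff ℝ 1 g → HasCompactSupport g → tsupport g ⊆ V →
        ∫ x in Ω, fderiv ℝ g x v =
          ∫ x, (inner ℝ (outwardNormal Ω x) v) • g x ∂(surfaceMeasure Ω) := by
    intro x
    by_cases hx : x ∈ frontier Ω
    · obtain ⟨r, R, γ, hr, h⟩ := hΩ.exists_chart hx
      exact ⟨_, h.isOpen, fun _ => Metric.mem_ball_self hr,
        fun g hg hgc hgV => h.setIntegral_fderiv hg hgc hgV v⟩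
    · refine ⟨Ω, hΩ.isOpen, fun h => ?_, fun g hg hgc hgV => ?_⟩
      · by_contra h'
        exact hx ⟨h, by rwa [hΩ.isOpen.interior_eq]⟩
      · rw [setIntegral_eq_integral_of_forall_compl_eq_zero, integral_fderiv_eq_zero _ hg hgc]
        · refine (integral_eq_zero_of_ae ?_).symm
          refine ae_restrict_of_forall_mem isClosed_frontier.measurableSet fun z hz => ?_
          have hz' : z ∉ Ω := by
            have := hz.2
            rwa [hΩ.isOpen.interior_eq] at this
          have : g z = 0 := Function.notMem_support.1 fun h' => hz' (hgV (subset_tsupport g h'))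
          simp [this]
        · intro z hz
          have : fderiv ℝ g z = 0 := by
            by_contra h0
            exact hz (hgV (support_fderiv_subset ℝ h0))
          rw [this]; rfl
  choose V hVo hVm hV using hopen
  obtain ⟨t, ht⟩ := hΩ.isBounded.isCompact_closure.elim_finite_subcover V hVo
    (fun x hx => mem_iUnion.2 ⟨x, hVm x hx⟩)
  -- bounded versions of the chart domains, so that the pieces have compact support
  obtain ⟨B, hB⟩ := hΩ.isBounded.closure.subset_ball 0
  let W : t → Set E3 := fun i => V i ∩ Metric.ball 0 B
  have hcov : closure Ω ⊆ ⋃ i, W i := fun x hx => by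
    obtain ⟨i, hi, hxi⟩ := mem_iUnion₂.1 (ht hx)
    exact mem_iUnion.2 ⟨⟨i, hi⟩, hxi, hB hx⟩
  obtain ⟨χ, hχ⟩ := SmoothPartitionOfUnity.exists_isSubordinate (modelWithCornersSelf ℝ E3)
    (isClosed_closure (s := Ω)) W (fun i => (hVo i).inter Metric.isOpen_ball) hcov
  have hχs (i : t) : ContDiff ℝ 1 fun x => (χ i x) • f x :=
    (((χ i).contMDiff.contDiff).of_le (by norm_cast)).smul hf
  have hsupp (i : t) : tsupport (fun x => (χ i x) • f x) ⊆ W i :=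
    (tsupport_smul_subset_left (χ i) f).trans (hχ i)
  have hcomp (i : t) : HasCompactSupport fun x => (χ i x) • f x :=
    (Metric.isBounded_ball.subset ((hsupp i).trans inter_subset_right)).isCompact_closure
      |>.of_isClosed_subset
      (isClosed_tsupport _) subset_closure
  have hone {x : E3} (hx : x ∈ closure Ω) : ∑ i, χ i x = 1 := by
    rw [← finsum_eq_sum_of_fintype]; exact χ.sum_eq_one hx
  have hdec {x : E3} (hx : x ∈ closure Ω) : ∑ i, (χ i x) • f x = f x := by
    rw [← Finset.sum_smul, hone hx, one_smul]
  have hL : ∫ x in Ω, fderiv ℝ f x v = ∑ i, ∫ x in Ω, fderiv ℝ (fun x => (χ i x) • f x) x v := by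
    rw [← integral_finsetSum]
    · refine setIntegral_congr_fun hΩ.isOpen.measurableSet fun x hx => ?_
      -- The partition sums to one only on the closure; openness of `Ω` upgrades this to an identity
      -- near `x`, so derivatives agree as well.
      have he : f =ᶠ[𝓝 x] fun x => ∑ i, (χ i x) • f x := by
        filter_upwards [hΩ.isOpen.mem_nhds hx] with z hz using (hdec (subset_closure hz)).symm
      rw [he.fderiv_eq, fderiv_fun_sum fun i _ => ((hχs i).differentiable one_ne_zero) x]
      simp
    · intro i _
      exact ((((hχs i).continuous_fderiv one_ne_zero).clm_apply
        continuous_const).integrable_of_hasCompactSupport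
          ((hcomp i).fderiv_apply (𝕜 := ℝ) v)).integrableOn
  have hR : ∫ x, (inner ℝ (outwardNormal Ω x) v) • f x ∂(surfaceMeasure Ω) =
      ∑ i, ∫ x, (inner ℝ (outwardNormal Ω x) v) • ((χ i x) • f x) ∂(surfaceMeasure Ω) := by
    rw [← integral_finsetSum]
    · refine setIntegral_congr_fun isClosed_frontier.measurableSet fun x hx => ?_
      rw [← Finset.smul_sum, hdec (frontier_subset_closure hx)]
    · intro i _
      exact hΩ.integrable_surfaceMeasure
        ((hΩ.continuousOn_inner_outwardNormal v).smul (hχs i).continuous.continuousOn)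
  rw [hL, hR]
  exact Finset.sum_congr rfl fun i _ =>
    hV i _ (hχs i) (hcomp i) ((hsupp i).trans inter_subset_left)

end IsBoundedC2Domain
/-! ### Green's formula for weak solutions -/

/-- Cauchy–Schwarz bounds the `L¹` distance of the products. This carries Green's formula from
smooth functions to `H¹` functions with a trace. -/
theorem tendsto_integral_mul_of_tendsto_eLpNorm_two {X : Type*} [MeasurableSpace X] {μ : Measure X}
    {φ : ℕ → X → ℂ} {u h : X → ℂ} (hφ : ∀ m, MemLp (φ m) 2 μ) (hu : MemLp u 2 μ)
    (hh : MemLp h 2 μ) (hlim : Tendsto (fun m => eLpNorm (φ m - u) 2 μ) atTop (𝓝 0)) :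
    Tendsto (fun m => ∫ x, φ m x * h x ∂μ) atTop (𝓝 (∫ x, u x * h x ∂μ)) := by
  refine tendsto_integral_of_L1' (fun x => u x * h x) (hu.integrable_mul hh).1
    (Eventually.of_forall fun m => (hφ m).integrable_mul hh) ?_
  have hb (m : ℕ) : eLpNorm ((fun x => φ m x * h x) - fun x => u x * h x) 1 μ ≤
      eLpNorm (φ m - u) 2 μ * eLpNorm h 2 μ := by
    have : ((fun x => φ m x * h x) - fun x => u x * h x) = (φ m - u) • h := by
      ext x; simp [sub_mul]
    rw [this]
    exact eLpNorm_smul_le_mul_eLpNorm hh.1 ((hφ m).1.sub hu.1)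
  refine tendsto_of_tendsto_of_tendsto_of_le_of_le tendsto_const_nhds ?_ (fun _ => zero_le) hb
  simpa using ENNReal.Tendsto.mul_const hlim (Or.inr hh.2.ne)

theorem contDiff_pderiv {f : E3 → ℂ} (hf : ContDiff ℝ (⊤ : ℕ∞) f) (j : Fin 3) :
    ContDiff ℝ (⊤ : ℕ∞) (pderiv j f) :=
  (hf.fderiv_right (m := (⊤ : ℕ∞)) (by norm_cast)).clm_apply contDiff_const

theorem pderiv_mul {f g : E3 → ℂ} {x : E3} (hf : DifferentiableAt ℝ f x)
    (hg : DifferentiableAt ℝ g x) (j : Fin 3) :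
    pderiv j (fun x => f x * g x) x = pderiv j f x * g x + f x * pderiv j g x := by
  rw [pderiv, fderiv_fun_mul hf hg]
  simp [pderiv]; ring

theorem fderiv_eq_sum_pderiv (w : E3 → ℂ) (x n : E3) :
    fderiv ℝ w x n = ∑ j, (inner ℝ n (EuclideanSpace.single j 1) : ℝ) • pderiv j w x := by
  have hn : n = ∑ j, (inner ℝ n (EuclideanSpace.single j 1) : ℝ) •
      (EuclideanSpace.single j 1 : E3) := by
    ext i
    fin_cases i <;> simp [EuclideanSpace.inner_single_right, Fin.sum_univ_three]
  conv_lhs => rw [hn]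
  rw [map_sum]
  simp [pderiv]

namespace IsBoundedC2Domain

variable {Ω : Set E3}

theorem memLp_volume (hΩ : IsBoundedC2Domain Ω) {f : E3 → ℂ} (hf : Continuous f) (p : ℝ≥0∞) :
    MemLp f p (volume.restrict Ω) := by
  have := hΩ.isFiniteMeasure_volume
  obtain ⟨C, hC⟩ := hΩ.isBounded.isCompact_closure.exists_bound_of_continuousOn hf.continuousOn
  exact MemLp.of_bound hf.aestronglyMeasurable C
    (ae_restrict_of_forall_mem hΩ.isOpen.measurableSet fun x hx => hC x (subset_closure hx))

theorem memLp_surfaceMeasure (hΩ : IsBoundedC2Domain Ω) {f : E3 → ℂ}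
    (hf : ContinuousOn f (frontier Ω)) (p : ℝ≥0∞) : MemLp f p (surfaceMeasure Ω) := by
  have := hΩ.isFiniteMeasure_surfaceMeasure
  obtain ⟨C, hC⟩ := hΩ.isCompact_frontier.exists_bound_of_continuousOn hf
  exact MemLp.of_bound (hf.aestronglyMeasurable isClosed_frontier.measurableSet) C
    (ae_restrict_of_forall_mem isClosed_frontier.measurableSet hC)

theorem isH1_of_contDiff (hΩ : IsBoundedC2Domain Ω) {w : E3 → ℂ}
    (hw : ContDiff ℝ (⊤ : ℕ∞) w) : IsH1 Ω w fun j => pderiv j w := by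
  refine ⟨hΩ.memLp_volume hw.continuous _,
    fun j => hΩ.memLp_volume (contDiff_pderiv hw j).continuous _, ?_⟩
  rintro φ ⟨hφ, hφc, hφs⟩ j
  have hd := contDiff_pderiv hw j
  have hdφ := contDiff_pderiv hφ j
  have hcd : HasCompactSupport (pderiv j φ) := hφc.fderiv_apply (𝕜 := ℝ) _
  rw [setIntegral_eq_integral_of_forall_compl_eq_zero,
    setIntegral_eq_integral_of_forall_compl_eq_zero]
  · have htop : ((⊤ : ℕ∞) : WithTop ℕ∞) ≠ 0 := by simp
    exact integral_mul_fderiv_eq_neg_fderiv_mul_of_integrable (𝕜 := ℂ)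
      ((hd.continuous.mul hφ.continuous).integrable_of_hasCompactSupport hφc.mul_left)
      ((hw.continuous.mul hdφ.continuous).integrable_of_hasCompactSupport hcd.mul_left)
      ((hw.continuous.mul hφ.continuous).integrable_of_hasCompactSupport hφc.mul_left)
      (fun x _ => hw.differentiable htop x) (fun x _ => hφ.differentiable htop x)
  · intro x hx
    rw [Function.notMem_support.1 fun h => hx (hφs (subset_tsupport φ h)), mul_zero]
  · intro x hx
    have : fderiv ℝ φ x = 0 := by
      by_contra h0
      exact hx (hφs (support_fderiv_subset ℝ h0))
    rw [pderiv, this]; simp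

theorem isTrace_of_contDiff (hΩ : IsBoundedC2Domain Ω) {w : E3 → ℂ}
    (hw : ContDiff ℝ (⊤ : ℕ∞) w) : IsTrace Ω w (fun j => pderiv j w) w :=
  ⟨hΩ.memLp_surfaceMeasure hw.continuous.continuousOn _, fun _ => w, fun _ => hw, by simp,
    by simp, by simp⟩

/-- Green's first formula for smooth functions. -/
theorem setIntegral_normal_deriv_mul (hΩ : IsBoundedC2Domain Ω) {w φ : E3 → ℂ}
    (hw : ContDiff ℝ (⊤ : ℕ∞) w) (hφ : ContDiff ℝ (⊤ : ℕ∞) φ) :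
    ∫ x, φ x * fderiv ℝ w x (outwardNormal Ω x) ∂(surfaceMeasure Ω) =
      ∑ j, ((∫ x in Ω, pderiv j φ x * pderiv j w x) +
        ∫ x in Ω, φ x * pderiv j (pderiv j w) x) := by
  have htop : ((⊤ : ℕ∞) : WithTop ℕ∞) ≠ 0 := by simp
  have := hΩ.isFiniteMeasure_volume
  have hs : ∀ x, φ x * fderiv ℝ w x (outwardNormal Ω x) =
      ∑ j, (inner ℝ (outwardNormal Ω x) (EuclideanSpace.single j 1) : ℝ) •
        (φ x * pderiv j w x) := fun x => by
    rw [fderiv_eq_sum_pderiv, Finset.mul_sum]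
    exact Finset.sum_congr rfl fun j _ => mul_smul_comm _ _ _
  simp_rw [hs]
  rw [integral_finsetSum]
  · refine Finset.sum_congr rfl fun j _ => ?_
    have hp : ContDiff ℝ 1 fun x => φ x * pderiv j w x :=
      (hφ.mul (contDiff_pderiv hw j)).of_le (by norm_cast)
    rw [← hΩ.setIntegral_fderiv hp, ← integral_add]
    · refine integral_congr_ae (ae_of_all _ fun x => ?_)
      exact pderiv_mul (hφ.differentiable htop x) ((contDiff_pderiv hw j).differentiable htop x) j
    · exact (hΩ.memLp_volume ((contDiff_pderiv hφ j).continuous.mul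
        (contDiff_pderiv hw j).continuous) 1).integrable le_rfl
    · exact (hΩ.memLp_volume (hφ.continuous.mul
        (contDiff_pderiv (contDiff_pderiv hw j) j).continuous) 1).integrable le_rfl
  · intro j _
    exact hΩ.integrable_surfaceMeasure ((hΩ.continuousOn_inner_outwardNormal _).smul
      (hφ.continuous.mul (contDiff_pderiv hw j).continuous).continuousOn)

theorem continuousOn_normal_deriv (hΩ : IsBoundedC2Domain Ω) {w : E3 → ℂ}
    (hw : ContDiff ℝ (⊤ : ℕ∞) w) :
    ContinuousOn (fun x => fderiv ℝ w x (outwardNormal Ω x)) (frontier Ω) :=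
  (hw.continuous_fderiv (by simp)).continuousOn.clm_apply hΩ.continuousOn_outwardNormal

/-- Green's first formula for an `H¹` function with a trace. -/
theorem integral_normal_deriv_mul_trace (hΩ : IsBoundedC2Domain Ω) {u g : E3 → ℂ}
    {G : Fin 3 → E3 → ℂ} (hu : IsH1 Ω u G) (hg : IsTrace Ω u G g) {w : E3 → ℂ}
    (hw : ContDiff ℝ (⊤ : ℕ∞) w) :
    ∫ x, g x * fderiv ℝ w x (outwardNormal Ω x) ∂(surfaceMeasure Ω) =
      ∑ j, ((∫ x in Ω, G j x * pderiv j w x) + ∫ x in Ω, u x * pderiv j (pderiv j w) x) := by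
  obtain ⟨hg2, φ, hφ, h1, h2, h3⟩ := hg
  have hlim := tendsto_integral_mul_of_tendsto_eLpNorm_two
    (fun m => hΩ.memLp_surfaceMeasure (hφ m).continuous.continuousOn 2) hg2
    (hΩ.memLp_surfaceMeasure (hΩ.continuousOn_normal_deriv hw) 2) h3
  refine tendsto_nhds_unique hlim ?_
  simp_rw [hΩ.setIntegral_normal_deriv_mul hw (hφ _)]
  refine tendsto_finsetSum _ fun j _ => Tendsto.add ?_ ?_
  · exact tendsto_integral_mul_of_tendsto_eLpNorm_two
      (fun m => hΩ.memLp_volume (contDiff_pderiv (hφ m) j).continuous 2) (hu.memLp_grad j)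
      (hΩ.memLp_volume (contDiff_pderiv hw j).continuous 2) (h2 j)
  · exact tendsto_integral_mul_of_tendsto_eLpNorm_two
      (fun m => hΩ.memLp_volume (hφ m).continuous 2) hu.memLp
      (hΩ.memLp_volume (contDiff_pderiv (contDiff_pderiv hw j) j).continuous 2) h1

/-- Pairing Cauchy data with a smooth solution of the Helmholtz equation recovers the source. -/
theorem boundaryPairing_eq (hΩ : IsBoundedC2Domain Ω) {k : ℝ} {F u g : E3 → ℂ}
    {G : Fin 3 → E3 → ℂ} {Λ : (E3 → ℂ) → ℂ} (hF : MemLp F 2 (volume.restrict Ω))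
    (hu : IsH1 Ω u G) (hC : IsCauchyData Ω k F u G g Λ) {w : E3 → ℂ}
    (hw : ContDiff ℝ (⊤ : ℕ∞) w)
    (hhelm : ∀ x, ∑ j, pderiv j (pderiv j w) x = -(k : ℂ) ^ 2 * w x) :
    boundaryPairing Ω g Λ w = ∫ x in Ω, F x * w x := by
  have hGi (j : Fin 3) : IntegrableOn (fun x => G j x * pderiv j w x) Ω :=
    (hu.memLp_grad j).integrable_mul (hΩ.memLp_volume (contDiff_pderiv hw j).continuous 2)
  have hui : IntegrableOn (fun x => u x * w x) Ω :=
    hu.memLp.integrable_mul (hΩ.memLp_volume hw.continuous 2)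
  have huj (j : Fin 3) : IntegrableOn (fun x => u x * pderiv j (pderiv j w) x) Ω :=
    hu.memLp.integrable_mul
      (hΩ.memLp_volume (contDiff_pderiv (contDiff_pderiv hw j) j).continuous 2)
  have hFi : IntegrableOn (fun x => F x * w x) Ω :=
    hF.integrable_mul (hΩ.memLp_volume hw.continuous 2)
  have hmul : ∀ x, fderiv ℝ w x (outwardNormal Ω x) * g x =
      g x * fderiv ℝ w x (outwardNormal Ω x) := fun x => mul_comm _ _
  -- The weak normal derivative may be tested on `w`, which is smooth and hence its own trace. The
  -- gradient terms then cancel against Green's formula, and the terms in `u` cancel by the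
  -- Helmholtz equation.
  rw [boundaryPairing, hC.normal_deriv w _ w (hΩ.isH1_of_contDiff hw) (hΩ.isTrace_of_contDiff hw)]
  simp_rw [hmul]
  rw [hΩ.integral_normal_deriv_mul_trace hu hC.isTrace hw, Finset.sum_add_distrib,
    ← integral_finsetSum _ fun j _ => hGi j, ← integral_finsetSum _ fun j _ => huj j]
  have e1 : ∀ x, ∑ j, u x * pderiv j (pderiv j w) x = -(k : ℂ) ^ 2 * (u x * w x) := fun x => by
    rw [← Finset.mul_sum, hhelm]; ring
  have e2 : ∀ x, (∑ j, G j x * pderiv j w x) + (F x - (k : ℂ) ^ 2 * u x) * w x =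
      (∑ j, G j x * pderiv j w x) + (F x * w x - (k : ℂ) ^ 2 * (u x * w x)) := fun x => by ring
  have hsub : IntegrableOn (fun x => F x * w x - (k : ℂ) ^ 2 * (u x * w x)) Ω :=
    hFi.sub (hui.const_mul _)
  simp_rw [e1, e2]
  rw [integral_add (integrable_finsetSum _ fun j _ => hGi j) hsub,
    integral_sub hFi (hui.const_mul _), integral_const_mul, integral_const_mul]
  ring

end IsBoundedC2Domain

theorem memLp_source {Ω D : Set E3} (hD : IsOpen D) {ρ : E3 → ℂ}
    (hρ : MemLp ρ 2 (volume.restrict D)) : MemLp (source ρ D) 2 (volume.restrict Ω) :=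
  ((memLp_indicator_iff_restrict hD.measurableSet).2 hρ).restrict Ω

theorem setIntegral_source_mul {Ω D : Set E3} (hD : IsOpen D) (hDΩ : D ⊆ Ω) (ρ w : E3 → ℂ) :
    ∫ x in Ω, source ρ D x * w x = ∫ x in D, ρ x * w x := by
  have : ∀ x, source ρ D x * w x = D.indicator (fun x => ρ x * w x) x := fun x => by
    rw [source, indicator_mul_left]
  simp_rw [this]
  rw [setIntegral_indicator hD.measurableSet, inter_eq_right.2 hDΩ]

/-! ### The exponential solutions -/

/-- The complex frequency `ζ = τ ω + i √(τ² + k²) ϑ`. -/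
noncomputable def cgoFreq (k : ℝ) (ω ϑ : E3) (τ : ℝ) (j : Fin 3) : ℂ :=
  τ * ω j + Complex.I * (√(τ ^ 2 + k ^ 2) * ϑ j : ℝ)

/-- The `τ`-derivative `ω + i τ / √(τ² + k²) ϑ` of the complex frequency. -/
noncomputable def cgoFreqDeriv (k : ℝ) (ω ϑ : E3) (τ : ℝ) (j : Fin 3) : ℂ :=
  ω j + Complex.I * (τ / √(τ ^ 2 + k ^ 2) * ϑ j : ℝ)

/-- The complex linear form `x ↦ x · ζ`. -/
noncomputable def clinear (ζ : Fin 3 → ℂ) (x : E3) : ℂ := ∑ j, (x j : ℂ) * ζ j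

theorem hasFDerivAt_clinear (ζ : Fin 3 → ℂ) (x : E3) : ∃ L : E3 →L[ℝ] ℂ,
    HasFDerivAt (clinear ζ) L x ∧ ∀ j, L (EuclideanSpace.single j 1) = ζ j := by
  let L : E3 →ₗ[ℝ] ℂ :=
    { toFun := clinear ζ
      map_add' := fun a b => by simp [clinear, add_mul, Finset.sum_add_distrib]
      map_smul' := fun c a => by simp [clinear, Finset.mul_sum, mul_assoc] }
  refine ⟨L.toContinuousLinearMap, L.toContinuousLinearMap.hasFDerivAt, fun j => ?_⟩
  change clinear ζ _ = _
  fin_cases j <;> simp [clinear, Fin.sum_univ_three]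

theorem contDiff_clinear (ζ : Fin 3 → ℂ) : ContDiff ℝ (⊤ : ℕ∞) (clinear ζ) := by
  unfold clinear
  refine ContDiff.sum fun j _ => ContDiff.mul ?_ contDiff_const
  exact Complex.ofRealCLM.contDiff.comp (EuclideanSpace.proj (𝕜 := ℝ) j).contDiff

theorem pderiv_clinear (ζ : Fin 3 → ℂ) (j : Fin 3) : pderiv j (clinear ζ) = fun _ => ζ j := by
  ext x
  obtain ⟨L, hL, h⟩ := hasFDerivAt_clinear ζ x
  rw [pderiv, hL.fderiv, h]

theorem pderiv_exp_clinear (ζ : Fin 3 → ℂ) (j : Fin 3) :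
    pderiv j (fun x => Complex.exp (clinear ζ x)) =
      fun x => ζ j * Complex.exp (clinear ζ x) := by
  ext x
  obtain ⟨L, hL, h⟩ := hasFDerivAt_clinear ζ x
  rw [pderiv, hL.cexp.fderiv]
  simp [h, mul_comm]

theorem contDiff_exp_clinear (ζ : Fin 3 → ℂ) :
    ContDiff ℝ (⊤ : ℕ∞) fun x => Complex.exp (clinear ζ x) :=
  (contDiff_clinear ζ).cexp

theorem pderiv_const_mul {f : E3 → ℂ} (hf : Differentiable ℝ f) (c : ℂ) (j : Fin 3) :
    pderiv j (fun x => c * f x) = fun x => c * pderiv j f x := by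
  ext x
  rw [pderiv, fderiv_const_mul (hf x)]; rfl

theorem laplacian_exp_clinear (ζ : Fin 3 → ℂ) (x : E3) :
    ∑ j, pderiv j (pderiv j fun x => Complex.exp (clinear ζ x)) x =
      (∑ j, ζ j ^ 2) * Complex.exp (clinear ζ x) := by
  rw [Finset.sum_mul]
  refine Finset.sum_congr rfl fun j _ => ?_
  rw [pderiv_exp_clinear, pderiv_const_mul ((contDiff_exp_clinear ζ).differentiable (by simp)),
    pderiv_exp_clinear]
  ring

theorem laplacian_clinear_mul_exp (ξ ζ : Fin 3 → ℂ) (x : E3) :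
    ∑ j, pderiv j (pderiv j fun x => clinear ξ x * Complex.exp (clinear ζ x)) x =
      (2 * (∑ j, ξ j * ζ j) + (∑ j, ζ j ^ 2) * clinear ξ x) * Complex.exp (clinear ζ x) := by
  have htop : ((⊤ : ℕ∞) : WithTop ℕ∞) ≠ 0 := by simp
  have hE := (contDiff_exp_clinear ζ).differentiable htop
  have hξ := (contDiff_clinear ξ).differentiable htop
  have h1 (j : Fin 3) : pderiv j (fun x => clinear ξ x * Complex.exp (clinear ζ x)) =
      fun x => (ξ j + ζ j * clinear ξ x) * Complex.exp (clinear ζ x) := by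
    ext x
    rw [pderiv_mul (hξ x) (hE x), pderiv_clinear, pderiv_exp_clinear]; ring
  have h2 (j : Fin 3) : pderiv j (pderiv j fun x => clinear ξ x * Complex.exp (clinear ζ x)) x =
      (2 * (ξ j * ζ j) + ζ j ^ 2 * clinear ξ x) * Complex.exp (clinear ζ x) := by
    have hd : Differentiable ℝ fun x => ξ j + ζ j * clinear ξ x := by fun_prop
    have h3 : pderiv j (fun x => ξ j + ζ j * clinear ξ x) x = ζ j * ξ j := by
      rw [pderiv, fderiv_const_add, ← pderiv, pderiv_const_mul hξ, pderiv_clinear]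
    rw [h1, pderiv_mul (hd x) (hE x), h3, pderiv_exp_clinear]
    ring
  simp_rw [h2]
  rw [← Finset.sum_mul, Finset.sum_add_distrib, ← Finset.mul_sum, ← Finset.sum_mul]

theorem dot_eq_sum (x y : E3) : dot x y = ∑ j, x j * y j := by
  simp [dot, PiLp.inner_apply, mul_comm]

theorem cgo_eq (k : ℝ) (ω ϑ : E3) (τ : ℝ) :
    cgo k ω ϑ τ = fun x => Complex.exp (clinear (cgoFreq k ω ϑ τ) x) := by
  ext x
  rw [cgo, clinear]
  congr 1
  simp only [cgoFreq, dot_eq_sum, Fin.sum_univ_three]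
  push_cast; ring

theorem cgoDeriv_eq (k : ℝ) (ω ϑ : E3) (τ : ℝ) :
    cgoDeriv k ω ϑ τ = fun x => clinear (cgoFreqDeriv k ω ϑ τ) x *
      Complex.exp (clinear (cgoFreq k ω ϑ τ) x) := by
  ext x
  rw [cgoDeriv, cgo_eq, clinear]
  congr 1
  simp only [cgoFreqDeriv, dot_eq_sum, Fin.sum_univ_three]
  push_cast; ring

/-- As `ω` and `ϑ` are orthonormal, the sum is `τ² - (τ² + k²)`. This makes `v` a Helmholtz
solution. -/
theorem sum_cgoFreq_sq {k : ℝ} {ω ϑ : E3} (hω : ‖ω‖ = 1) (hϑ : ϑ ∈ perpSphere ω) (τ : ℝ) :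
    ∑ j, cgoFreq k ω ϑ τ j ^ 2 = -(k : ℂ) ^ 2 := by
  have h1 : (∑ j, (ω j : ℂ) * ω j) = 1 := by
    have : dot ω ω = 1 := by rw [dot, real_inner_self_eq_norm_sq, hω, one_pow]
    rw [dot_eq_sum] at this; exact_mod_cast this
  have h2 : (∑ j, (ϑ j : ℂ) * ϑ j) = 1 := by
    have : dot ϑ ϑ = 1 := by rw [dot, real_inner_self_eq_norm_sq, hϑ.1, one_pow]
    rw [dot_eq_sum] at this; exact_mod_cast this
  have h3 : (∑ j, (ω j : ℂ) * ϑ j) = 0 := by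
    have := hϑ.2
    rw [dot_eq_sum] at this; exact_mod_cast this
  have h4 : ((√(τ ^ 2 + k ^ 2) : ℝ) : ℂ) ^ 2 = (τ : ℂ) ^ 2 + (k : ℂ) ^ 2 := by
    rw [← Complex.ofReal_pow, Real.sq_sqrt (by positivity)]; push_cast; ring
  have h5 : ∀ j, cgoFreq k ω ϑ τ j ^ 2 = (τ : ℂ) ^ 2 * ((ω j : ℂ) * ω j) +
      2 * τ * Complex.I * (√(τ ^ 2 + k ^ 2) : ℝ) * ((ω j : ℂ) * ϑ j) -
        ((√(τ ^ 2 + k ^ 2) : ℝ) : ℂ) ^ 2 * ((ϑ j : ℂ) * ϑ j) := fun j => by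
    rw [cgoFreq]; push_cast; ring_nf; rw [Complex.I_sq]; ring
  simp_rw [h5]
  rw [Finset.sum_sub_distrib, Finset.sum_add_distrib, ← Finset.mul_sum, ← Finset.mul_sum,
    ← Finset.mul_sum, h1, h2, h3, h4]
  ring

/-- This is half the `τ`-derivative of the constant `ζ·ζ`. It removes the cross term from the
Laplacian of `v_τ`, which therefore solves the same equation. -/
theorem sum_cgoFreqDeriv_mul_cgoFreq {k : ℝ} {ω ϑ : E3} (hω : ‖ω‖ = 1)
    (hϑ : ϑ ∈ perpSphere ω) {τ : ℝ} (hτ : 0 < τ) :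
    ∑ j, cgoFreqDeriv k ω ϑ τ j * cgoFreq k ω ϑ τ j = 0 := by
  have h1 : (∑ j, (ω j : ℂ) * ω j) = 1 := by
    have : dot ω ω = 1 := by rw [dot, real_inner_self_eq_norm_sq, hω, one_pow]
    rw [dot_eq_sum] at this; exact_mod_cast this
  have h2 : (∑ j, (ϑ j : ℂ) * ϑ j) = 1 := by
    have : dot ϑ ϑ = 1 := by rw [dot, real_inner_self_eq_norm_sq, hϑ.1, one_pow]
    rw [dot_eq_sum] at this; exact_mod_cast this
  have h3 : (∑ j, (ω j : ℂ) * ϑ j) = 0 := by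
    have := hϑ.2
    rw [dot_eq_sum] at this; exact_mod_cast this
  have h0 : (√(τ ^ 2 + k ^ 2) : ℝ) ≠ 0 := by positivity
  have h4 : ((τ / √(τ ^ 2 + k ^ 2) : ℝ) : ℂ) * (√(τ ^ 2 + k ^ 2) : ℝ) = τ := by
    rw [← Complex.ofReal_mul, div_mul_cancel₀ _ h0]
  have h5 : ∀ j, cgoFreqDeriv k ω ϑ τ j * cgoFreq k ω ϑ τ j = (τ : ℂ) * ((ω j : ℂ) * ω j) +
      (Complex.I * (√(τ ^ 2 + k ^ 2) : ℝ) + Complex.I * τ * (τ / √(τ ^ 2 + k ^ 2) : ℝ)) *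
        ((ω j : ℂ) * ϑ j) - (((τ / √(τ ^ 2 + k ^ 2) : ℝ) : ℂ) * (√(τ ^ 2 + k ^ 2) : ℝ)) *
          ((ϑ j : ℂ) * ϑ j) := fun j => by
    rw [cgoFreq, cgoFreqDeriv, Complex.ofReal_mul, Complex.ofReal_mul]
    linear_combination (((τ / √(τ ^ 2 + k ^ 2) : ℝ) : ℂ) * (√(τ ^ 2 + k ^ 2) : ℝ)) *
          ((ϑ j : ℂ) * ϑ j) * Complex.I_sq
  simp_rw [h5]
  rw [Finset.sum_sub_distrib, Finset.sum_add_distrib, ← Finset.mul_sum, ← Finset.mul_sum,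
    ← Finset.mul_sum, h1, h2, h3, h4]
  ring

section Indicator

variable {Ω D : Set E3} {k : ℝ} {ρ u g : E3 → ℂ} {G : Fin 3 → E3 → ℂ} {Λ : (E3 → ℂ) → ℂ}

theorem indicatorFn_eq (hΩ : IsBoundedC2Domain Ω) (hD : IsOpen D) (hDΩ : D ⊆ Ω)
    (hρ : MemLp ρ 2 (volume.restrict D)) (hu : IsH1 Ω u G)
    (hC : IsCauchyData Ω k (source ρ D) u G g Λ) {ω ϑ : E3} (hω : ‖ω‖ = 1)
    (hϑ : ϑ ∈ perpSphere ω) (τ : ℝ) :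
    indicatorFn Ω k g Λ ω ϑ τ = ∫ x in D, ρ x * cgo k ω ϑ τ x := by
  rw [indicatorFn, hΩ.boundaryPairing_eq (memLp_source hD hρ) hu hC,
    setIntegral_source_mul hD hDΩ]
  · rw [cgo_eq]; exact contDiff_exp_clinear _
  · intro x
    rw [cgo_eq, laplacian_exp_clinear, sum_cgoFreq_sq hω hϑ]

theorem indicatorFnDeriv_eq (hΩ : IsBoundedC2Domain Ω) (hD : IsOpen D) (hDΩ : D ⊆ Ω)
    (hρ : MemLp ρ 2 (volume.restrict D)) (hu : IsH1 Ω u G)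
    (hC : IsCauchyData Ω k (source ρ D) u G g Λ) {ω ϑ : E3} (hω : ‖ω‖ = 1)
    (hϑ : ϑ ∈ perpSphere ω) {τ : ℝ} (hτ : 0 < τ) :
    indicatorFnDeriv Ω k g Λ ω ϑ τ = ∫ x in D, ρ x * cgoDeriv k ω ϑ τ x := by
  rw [indicatorFnDeriv, hΩ.boundaryPairing_eq (memLp_source hD hρ) hu hC,
    setIntegral_source_mul hD hDΩ]
  · rw [cgoDeriv_eq]; exact (contDiff_clinear _).mul (contDiff_exp_clinear _)
  · intro x
    rw [cgoDeriv_eq, laplacian_clinear_mul_exp, sum_cgoFreq_sq hω hϑ,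
      sum_cgoFreqDeriv_mul_cgoFreq hω hϑ hτ]
    ring

end Indicator
/-! ### Differentiation in the parameter -/

theorem abs_dot_le (x y : E3) : |dot x y| ≤ ‖x‖ * ‖y‖ := abs_real_inner_le_norm x y

theorem norm_cgo (k : ℝ) (ω ϑ : E3) (τ : ℝ) (x : E3) :
    ‖cgo k ω ϑ τ x‖ = Real.exp (τ * dot x ω) := by
  rw [cgo, Complex.norm_exp]
  simp

theorem div_sqrt_sq_add_le_one (τ k : ℝ) : τ / √(τ ^ 2 + k ^ 2) ≤ 1 :=
  div_le_one_of_le₀ (Real.le_sqrt_of_sq_le (by nlinarith [sq_nonneg k])) (Real.sqrt_nonneg _)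

/-- The factor `x · (ω + i τ / √(τ² + k²) ϑ)` in `v_τ`. -/
noncomputable def cgoFactor (k : ℝ) (ω ϑ : E3) (τ : ℝ) (x : E3) : ℂ :=
  (dot x ω : ℂ) + Complex.I * (τ / √(τ ^ 2 + k ^ 2) * dot x ϑ : ℝ)

theorem cgoDeriv_eq_factor_mul (k : ℝ) (ω ϑ : E3) (τ : ℝ) (x : E3) :
    cgoDeriv k ω ϑ τ x = cgoFactor k ω ϑ τ x * cgo k ω ϑ τ x := rfl

theorem norm_cgoFactor_le (k : ℝ) {ω ϑ : E3} (hω : ‖ω‖ = 1) (hϑ : ‖ϑ‖ = 1) {τ : ℝ} (hτ : 0 < τ)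
    (x : E3) : ‖cgoFactor k ω ϑ τ x‖ ≤ 2 * ‖x‖ := by
  refine (norm_add_le _ _).trans ?_
  rw [norm_mul, Complex.norm_I, one_mul, Complex.norm_real, Complex.norm_real, Real.norm_eq_abs,
    Real.norm_eq_abs, abs_mul, abs_of_nonneg (by positivity : 0 ≤ τ / √(τ ^ 2 + k ^ 2))]
  have h1 := abs_dot_le x ω
  have h2 := abs_dot_le x ϑ
  rw [hω, mul_one] at h1
  rw [hϑ, mul_one] at h2
  have h3 : τ / √(τ ^ 2 + k ^ 2) * |dot x ϑ| ≤ 1 * ‖x‖ :=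
    mul_le_mul (div_sqrt_sq_add_le_one τ k) h2 (abs_nonneg _) zero_le_one
  linarith

theorem hasDerivAt_cgo (k : ℝ) (ω ϑ x : E3) {τ : ℝ} (hτ : 0 < τ) :
    HasDerivAt (fun τ => cgo k ω ϑ τ x) (cgoDeriv k ω ϑ τ x) τ := by
  have h0 : τ ^ 2 + k ^ 2 ≠ 0 := by positivity
  have h1 : HasDerivAt (fun τ : ℝ => √(τ ^ 2 + k ^ 2)) (τ / √(τ ^ 2 + k ^ 2)) τ := by
    have := (((hasDerivAt_id τ).pow 2).add_const (k ^ 2)).sqrt h0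
    refine this.congr_deriv ?_
    have h3 : √(τ ^ 2 + k ^ 2) ≠ 0 := by positivity
    simp only [Pi.pow_apply, id]
    field_simp
    simp
  have h2 : HasDerivAt (fun τ : ℝ => ((τ * dot x ω : ℝ) : ℂ) +
      Complex.I * (√(τ ^ 2 + k ^ 2) * dot x ϑ : ℝ)) (cgoFactor k ω ϑ τ x) τ := by
    have ha := ((hasDerivAt_id τ).mul_const (dot x ω)).ofReal_comp
    have hb := ((h1.mul_const (dot x ϑ)).ofReal_comp).const_mul Complex.I
    refine (ha.add hb).congr_deriv ?_
    simp [cgoFactor]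
  refine h2.cexp.congr_deriv ?_
  rw [cgoDeriv_eq_factor_mul, mul_comm]; rfl

theorem continuous_cgo (k : ℝ) (ω ϑ : E3) (τ : ℝ) : Continuous (cgo k ω ϑ τ) := by
  rw [cgo_eq]; exact (contDiff_exp_clinear _).continuous

theorem continuous_dot_left (y : E3) : Continuous fun x => dot x y := by
  unfold dot; fun_prop

theorem continuous_cgoFactor (k : ℝ) (ω ϑ : E3) (τ : ℝ) : Continuous (cgoFactor k ω ϑ τ) := by
  have h1 := continuous_dot_left ω
  have h2 := continuous_dot_left ϑ
  unfold cgoFactor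
  fun_prop

theorem hasDerivAt_integral_cgo {D : Set E3} (hDo : IsOpen D) (hDb : Bornology.IsBounded D)
    {ρ : E3 → ℂ} (hρ : IntegrableOn ρ D) (k : ℝ) {ω ϑ : E3} (hω : ‖ω‖ = 1) (hϑ : ‖ϑ‖ = 1)
    {τ : ℝ} (hτ : 0 < τ) :
    HasDerivAt (fun τ => ∫ x in D, ρ x * cgo k ω ϑ τ x) (∫ x in D, ρ x * cgoDeriv k ω ϑ τ x) τ := by
  obtain ⟨B, hB⟩ := hDb.exists_norm_le
  have hcgo (t : ℝ) (ht : t ∈ Ioo 0 (2 * τ)) (x : E3) (hx : x ∈ D) :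
      ‖cgo k ω ϑ t x‖ ≤ Real.exp (2 * τ * B) := by
    rw [norm_cgo]
    refine Real.exp_le_exp.2 ?_
    have h1 := (le_abs_self _).trans (abs_dot_le x ω)
    rw [hω, mul_one] at h1
    have h2 := hB x hx
    have h3 : 0 ≤ B := (norm_nonneg _).trans h2
    calc t * dot x ω ≤ t * B := by gcongr; exacts [ht.1.le, h1.trans h2]
      _ ≤ 2 * τ * B := by gcongr; exact ht.2.le
  have hm (t : ℝ) : AEStronglyMeasurable (fun x => ρ x * cgo k ω ϑ t x) (volume.restrict D) :=
    hρ.1.mul (continuous_cgo k ω ϑ t).aestronglyMeasurable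
  refine (hasDerivAt_integral_of_dominated_loc_of_deriv_le (μ := volume.restrict D)
    (F := fun t x => ρ x * cgo k ω ϑ t x) (F' := fun t x => ρ x * cgoDeriv k ω ϑ t x)
    -- This window keeps the parameter positive, so that the square root is differentiable even for
    -- `k = 0`, and bounds the exponent by `2τB` on `D`.
    (s := Ioo 0 (2 * τ)) (bound := fun x => ‖ρ x‖ * (2 * B * Real.exp (2 * τ * B)))
    (Ioo_mem_nhds hτ (by linarith)) (Eventually.of_forall hm) ?_ ?_ ?_ ?_ ?_).2
  · refine (hρ.norm.mul_const (Real.exp (2 * τ * B))).mono' (hm τ) ?_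
    refine ae_restrict_of_forall_mem hDo.measurableSet fun x hx => ?_
    rw [norm_mul]
    exact mul_le_mul_of_nonneg_left (hcgo τ ⟨hτ, by linarith⟩ x hx) (norm_nonneg _)
  · exact hρ.1.mul ((continuous_cgoFactor k ω ϑ τ).mul
      (continuous_cgo k ω ϑ τ)).aestronglyMeasurable
  · refine ae_restrict_of_forall_mem hDo.measurableSet fun x hx t ht => ?_
    rw [norm_mul, cgoDeriv_eq_factor_mul, norm_mul]
    refine mul_le_mul_of_nonneg_left (mul_le_mul ?_ (hcgo t ht x hx) (norm_nonneg _) ?_)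
      (norm_nonneg _)
    · exact (norm_cgoFactor_le k hω hϑ ht.1 x).trans (by linarith [hB x hx])
    · linarith [norm_nonneg x, hB x hx]
  · exact hρ.norm.mul_const _
  · refine ae_restrict_of_forall_mem hDo.measurableSet fun x hx t ht => ?_
    exact (hasDerivAt_cgo k ω ϑ x ht.1).const_mul _

/-! ### Conical coordinates -/

/-- The vertical unit vector and `ω` have equal length, so the reflection in the hyperplane
orthogonal to their difference exchanges them. -/
theorem exists_frame_eq {ω : E3} (hω : ‖ω‖ = 1) : ∃ R : E3 ≃ₗᵢ[ℝ] E3, frame R (0, 1) = ω := by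
  set e : E3 := stdFrame (WithLp.toLp 2 (0, 1))
  have he : ‖e‖ = ‖ω‖ := by
    rw [hω, LinearIsometryEquiv.norm_map]
    have : ‖(WithLp.toLp 2 ((0 : E2), (1 : ℝ)))‖ ^ 2 = 1 := by
      rw [WithLp.prod_norm_sq_eq_of_L2]; simp
    nlinarith [norm_nonneg (WithLp.toLp 2 ((0 : E2), (1 : ℝ)))]
  refine ⟨(Submodule.reflection (ℝ ∙ (e - ω))ᗮ).symm, ?_⟩
  rw [frame_apply, LinearIsometryEquiv.symm_symm]
  exact Submodule.reflection_sub he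

theorem dot_frame {R : E3 ≃ₗᵢ[ℝ] E3} {ω : E3} (hR : frame R (0, 1) = ω) (q : E2 × ℝ) :
    dot (frame R q) ω = q.2 := by
  rw [dot, ← hR, inner_frame]; simp

/-- The truncated cone with apex `p`, height `ε` and angular base `A`. -/
def angularCone (R : E3 ≃ₗᵢ[ℝ] E3) (p : E3) (A : Set E2) (ε : ℝ) : Set E3 :=
  {x | ∃ s ∈ Ioo 0 ε, ∃ y ∈ A, x = p + s • frame R (y, -1)}

theorem frame_smul_neg_one (R : E3 ≃ₗᵢ[ℝ] E3) (s : ℝ) (y : E2) :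
    s • frame R (y, -1) = frame R (s • y, -s) := by
  rw [← map_smul]; simp

/-- The coordinates `(y, s) ↦ p + (y, -s)`. -/
noncomputable def apexCoord (R : E3 ≃ₗᵢ[ℝ] E3) (p : E3) : (E2 × ℝ) ≃ₜ E3 :=
  ((Homeomorph.refl E2).prodCongr (Homeomorph.neg ℝ)).trans
    ((frame R).toHomeomorph.trans (Homeomorph.addLeft p))

theorem apexCoord_apply (R : E3 ≃ₗᵢ[ℝ] E3) (p : E3) (q : E2 × ℝ) :
    apexCoord R p q = p + frame R (q.1, -q.2) := rfl

theorem apexCoord_measurePreserving (R : E3 ≃ₗᵢ[ℝ] E3) (p : E3) :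
    MeasurePreserving (apexCoord R p) :=
  (measurePreserving_add_left volume p).comp ((frame_measurePreserving R).comp
    ((MeasurePreserving.id volume).prod (Measure.measurePreserving_neg volume)))

theorem apexCoord_preimage_angularCone (R : E3 ≃ₗᵢ[ℝ] E3) (p : E3) (A : Set E2) (ε : ℝ) :
    apexCoord R p ⁻¹' angularCone R p A ε = {q | q.2 ∈ Ioo 0 ε ∧ q.2⁻¹ • q.1 ∈ A} := by
  ext ⟨y, s⟩
  simp only [mem_preimage, angularCone, mem_ofPred_eq, apexCoord_apply]
  constructor
  · rintro ⟨t, ht, z, hz, h⟩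
    rw [frame_smul_neg_one, add_right_inj] at h
    have h' := (frame R).injective h
    simp only [Prod.mk.injEq, neg_inj] at h'
    obtain ⟨rfl, rfl⟩ := h'
    refine ⟨ht, ?_⟩
    rwa [smul_smul, inv_mul_cancel₀ ht.1.ne', one_smul]
  · rintro ⟨hs, hy⟩
    refine ⟨s, hs, _, hy, ?_⟩
    rw [frame_smul_neg_one, smul_smul, mul_inv_cancel₀ hs.1.ne', one_smul]

theorem isOpen_angularCone (R : E3 ≃ₗᵢ[ℝ] E3) (p : E3) {A : Set E2} (hA : IsOpen A) (ε : ℝ) :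
    IsOpen (angularCone R p A ε) := by
  rw [← (apexCoord R p).isOpen_preimage, apexCoord_preimage_angularCone]
  have hU : IsOpen {q : E2 × ℝ | q.2 ∈ Ioo 0 ε} := isOpen_Ioo.preimage continuous_snd
  have hc : ContinuousOn (fun q : E2 × ℝ => q.2⁻¹ • q.1) {q | q.2 ∈ Ioo 0 ε} :=
    (continuousOn_snd.inv₀ fun q hq => hq.1.ne').smul continuousOn_fst
  exact hc.isOpen_inter_preimage hU hA

/-- Integration over a cone in polar form. -/
theorem setIntegral_angularCone (R : E3 ≃ₗᵢ[ℝ] E3) (p : E3) {A : Set E2} (hA : IsOpen A) (ε : ℝ)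
    {F : E3 → ℂ} (hF : IntegrableOn F (angularCone R p A ε)) :
    ∫ x in angularCone R p A ε, F x =
      ∫ s in Ioo 0 ε, ∫ y in A, (s ^ 2 : ℝ) • F (p + s • frame R (y, -1)) := by
  set P : Set (E2 × ℝ) := {q | q.2 ∈ Ioo 0 ε ∧ q.2⁻¹ • q.1 ∈ A} with hPdef
  have hP : apexCoord R p ⁻¹' angularCone R p A ε = P := apexCoord_preimage_angularCone R p A ε
  have hPm : MeasurableSet P := hP ▸
    ((isOpen_angularCone R p hA ε).preimage (apexCoord R p).continuous).measurableSet
  have hemb := (apexCoord R p).measurableEmbedding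
  have hmp := apexCoord_measurePreserving R p
  have hint : IntegrableOn (fun q => F (apexCoord R p q)) P := by
    rw [← hP]; exact (hmp.integrableOn_comp_preimage hemb).2 hF
  rw [← hmp.setIntegral_preimage_emb hemb, hP, ← integral_indicator hPm, Measure.volume_eq_prod,
    integral_prod_symm _ ((integrable_indicator_iff hPm).2 hint),
    ← integral_indicator measurableSet_Ioo]
  refine integral_congr_ae (ae_of_all _ fun s => ?_)
  simp only
  by_cases hs : s ∈ Ioo 0 ε
  · rw [indicator_of_mem hs, integral_smul]
    have h1 : ∀ y, P.indicator (fun q => F (apexCoord R p q)) (y, s) =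
        (A.indicator fun z => F (p + s • frame R (z, -1))) (s⁻¹ • y) := fun y => by
      by_cases hy : s⁻¹ • y ∈ A
      · rw [indicator_of_mem (show (y, s) ∈ P from ⟨hs, hy⟩), indicator_of_mem hy,
          apexCoord_apply, frame_smul_neg_one, smul_smul, mul_inv_cancel₀ hs.1.ne', one_smul]
      · rw [indicator_of_notMem (fun h : (y, s) ∈ P => hy h.2), indicator_of_notMem hy]
    simp_rw [h1]
    -- The section at depth `s` is the angular base scaled by `s`; planar scaling contributes the
    -- factor `s²`.
    rw [Measure.integral_comp_inv_smul, integral_indicator hA.measurableSet,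
      finrank_euclideanSpace_fin, abs_of_nonneg (by positivity)]
  · rw [indicator_of_notMem hs]
    refine integral_eq_zero_of_ae (ae_of_all _ fun y => ?_)
    exact indicator_of_notMem (fun h : (y, s) ∈ P => hs h.1) _

/-- The angular base of a cone with planar base `Q` and height `δ`. -/
def angularBase (R : E3 ≃ₗᵢ[ℝ] E3) (p : E3) (δ : ℝ) (Q : Set E3) : Set E2 :=
  {y | p + δ • frame R (y, -1) ∈ Q}

theorem dot_smul_frame {R : E3 ≃ₗᵢ[ℝ] E3} {ω : E3} (hR : frame R (0, 1) = ω) (p : E3) (s : ℝ)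
    (y : E2) : dot (p + s • frame R (y, -1)) ω = dot p ω - s := by
  have := dot_frame hR (y, -1)
  rw [dot] at this ⊢
  rw [inner_add_left, inner_smul_left, this, dot]; simp; ring

section Cone

variable {R : E3 ≃ₗᵢ[ℝ] E3} {ω p : E3} {δ : ℝ} {Q : Set E3}

theorem IsConeBase.isOpen_angularBase (hQ : IsConeBase p ω δ Q) (hR : frame R (0, 1) = ω) :
    IsOpen (angularBase R p δ Q) := by
  obtain ⟨-, -, U, hU, rfl⟩ := hQ
  have hc : Continuous fun y => p + δ • frame R (y, -1) := by fun_prop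
  convert! hU.preimage hc using 1
  ext y
  simp only [angularBase, mem_ofPred_eq, mem_inter_iff, mem_preimage, dot_smul_frame hR, and_true]

theorem IsConeBase.exists_norm_le (hQ : IsConeBase p ω δ Q) (hδ : 0 < δ) :
    ∃ B > 0, ∀ y ∈ angularBase R p δ Q, ‖frame R (y, -1)‖ ≤ B := by
  obtain ⟨C, hC⟩ := hQ.2.1.exists_norm_le
  refine ⟨(|C| + ‖p‖) / δ + 1, by positivity, fun y hy => ?_⟩
  have h1 := hC _ hy
  have h2 : ‖δ • frame R (y, -1)‖ ≤ |C| + ‖p‖ := by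
    have : δ • frame R (y, -1) = (p + δ • frame R (y, -1)) - p := by abel
    rw [this]
    exact (norm_sub_le _ _).trans (by linarith [le_abs_self C])
  rw [norm_smul, Real.norm_of_nonneg hδ.le, mul_comm, ← le_div_iff₀ hδ] at h2
  linarith

theorem IsConeBase.cone_eq (hQ : IsConeBase p ω δ Q) (hδ : 0 < δ) (hR : frame R (0, 1) = ω) :
    cone p δ Q = angularCone R p (angularBase R p δ Q) δ := by
  ext x
  constructor
  · rintro ⟨s, hs, z, hz, rfl⟩
    obtain ⟨⟨a, b⟩, hab⟩ := (frame R).surjective (z - p)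
    have hb : b = -δ := by
      have h1 : dot z ω = dot p ω - δ := by
        obtain ⟨-, -, U, hU, rfl⟩ := hQ
        exact hz.2
      have h2 := dot_frame hR (a, b)
      rw [hab, dot, inner_sub_left] at h2
      simp only [dot] at h1 h2
      linarith
    subst hb
    have hz' : δ • frame R (δ⁻¹ • a, -1) = z - p := by
      rw [frame_smul_neg_one, smul_smul, mul_inv_cancel₀ hδ.ne', one_smul, hab]
    refine ⟨s, hs, δ⁻¹ • a, ?_, ?_⟩
    · rw [angularBase, mem_ofPred_eq, hz', add_sub_cancel]; exact hz
    · rw [← hz', smul_smul, div_mul_cancel₀ _ hδ.ne']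
  · rintro ⟨s, hs, y, hy, rfl⟩
    refine ⟨s, hs, _, hy, ?_⟩
    rw [add_sub_cancel_left, smul_smul, div_mul_cancel₀ _ hδ.ne']

/-- The constant of a cone in angular coordinates. -/
noncomputable def angularConst (R : E3 ≃ₗᵢ[ℝ] E3) (A : Set E2) (ϑ : E3) : ℂ :=
  2 * ∫ y in A, 1 / (1 - Complex.I * (dot (frame R (y, -1)) ϑ : ℂ)) ^ 3

theorem setIntegral_isometry_image {X Y : Type*} [MetricSpace X] [MeasurableSpace X]
    [BorelSpace X] [CompleteSpace X] [MetricSpace Y] [MeasurableSpace Y] [BorelSpace Y]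
    {J : X → Y} (hJ : Isometry J) {S : Set X} (f : Y → ℂ) (d : ℕ) :
    ∫ z in J '' S, f z ∂(μHE[d] : Measure Y) = ∫ y in S, f (J y) ∂(μHE[d] : Measure X) := by
  have hJe : MeasurableEmbedding J := hJ.isClosedEmbedding.measurableEmbedding
  rw [← Measure.restrict_restrict_of_subset (image_subset_range J S),
    ← hJ.map_euclideanHausdorffMeasure, hJe.setIntegral_map, preimage_image_eq _ hJ.injective]

/-- The section is an isometric copy of `s • A`. The area scales like `s²` and the integrand like
`s⁻³`, which the prefactor `s` balances; hence the independence of `s`. -/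
theorem IsConeBase.coneConst_eq (hQ : IsConeBase p ω δ Q) (hδ : 0 < δ) (hR : frame R (0, 1) = ω)
    (ϑ : E3) {s : ℝ} (hs : s ∈ Ioo 0 δ) :
    coneConst p ω δ Q ϑ s = angularConst R (angularBase R p δ Q) ϑ := by
  set A := angularBase R p δ Q
  let J : E2 → E3 := fun y => p + frame R (y, -s)
  have hJ : Isometry J := by
    refine Isometry.of_dist_eq fun y y' => ?_
    rw [dist_eq_norm, dist_eq_norm, add_sub_add_left_eq_sub, ← map_sub,
      ← sq_eq_sq₀ (norm_nonneg _) (norm_nonneg _), norm_frame_sq]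
    simp
  have hsec : coneSection p ω δ Q s = J '' ((s • ·) '' A) := by
    rw [coneSection, hQ.cone_eq hδ hR, ← image_comp]
    ext x
    constructor
    · rintro ⟨⟨t, ht, y, hy, rfl⟩, h2⟩
      rw [mem_ofPred_eq, dot_smul_frame hR] at h2
      obtain rfl : t = s := by linarith
      exact ⟨y, hy, by simp only [Function.comp, J, frame_smul_neg_one]⟩
    · rintro ⟨y, hy, rfl⟩
      simp only [Function.comp, J, ← frame_smul_neg_one]
      exact ⟨⟨s, hs, y, hy, rfl⟩, dot_smul_frame hR p s y⟩
  have hs0 : (s : ℂ) ≠ 0 := by exact_mod_cast hs.1.ne'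
  have hscale := Measure.setIntegral_comp_smul_of_pos (volume : Measure E2)
    (fun y => 1 / ((s : ℂ) - Complex.I * (dot (J y - p) ϑ : ℂ)) ^ 3) A hs.1
  rw [finrank_euclideanSpace_fin] at hscale
  have hval : ∀ y, 1 / ((s : ℂ) - Complex.I * (dot (J (s • y) - p) ϑ : ℂ)) ^ 3 =
      ((s : ℂ) ^ 3)⁻¹ * (1 / (1 - Complex.I * (dot (frame R (y, -1)) ϑ : ℂ)) ^ 3) := fun y => by
    have : dot (J (s • y) - p) ϑ = s * dot (frame R (y, -1)) ϑ := by
      simp only [J, add_sub_cancel_left, ← frame_smul_neg_one, dot, inner_smul_left, conj_trivial]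
    rw [this, one_div, one_div, ← mul_inv, ← mul_pow]
    push_cast
    congr 2; ring
  simp_rw [hval] at hscale
  rw [integral_const_mul] at hscale
  rw [coneConst, hsec, setIntegral_isometry_image hJ,
    EuclideanSpace.euclideanHausdorffMeasure_eq_volume, angularConst]
  rw [← image_smul, Complex.real_smul] at hscale
  push_cast at hscale
  rw [inv_mul_eq_iff_eq_mul₀ (pow_ne_zero 3 hs0)] at hscale
  rw [hscale]
  field_simp

end Cone
/-! ### Laplace-type integrals over a cone -/

theorem exp_neg_mul_le_inv (x : ℝ) (hx : 0 < x) : x ^ 3 * Real.exp (-x) ≤ 24 / x := by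
  have h := Real.pow_div_factorial_le_exp x hx.le 4
  rw [div_le_iff₀ (by positivity)] at h
  norm_num [Nat.factorial] at h
  rw [Real.exp_neg, ← div_eq_mul_inv, div_le_div_iff₀ (Real.exp_pos _) hx]
  nlinarith

/-- The Taylor terms of the exponential give `x³ ≤ 6eˣ`, `2x² ≤ 4eˣ` and `2x ≤ 2eˣ`; the
coefficients add up to `12`. -/
theorem quadratic_mul_exp_neg_le (x : ℝ) (hx : 0 < x) :
    (x ^ 2 + 2 * x + 2) * Real.exp (-x) ≤ 12 / x := by
  have h1 := Real.pow_div_factorial_le_exp x hx.le 1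
  have h2 := Real.pow_div_factorial_le_exp x hx.le 2
  have h3 := Real.pow_div_factorial_le_exp x hx.le 3
  norm_num [Nat.factorial] at h1 h2 h3
  rw [Real.exp_neg, ← div_eq_mul_inv, div_le_div_iff₀ (Real.exp_pos _) hx]
  nlinarith

/-- The integral over the half line is `2/c³`, and truncation at `ε` leaves an explicit boundary
term. The exponential factor in it is traded for one power of `(ετ)⁻¹`, since an error `O(τ⁻¹)`
after multiplication by `τ³` is enough. -/
theorem norm_integral_sq_mul_exp_sub_le {c : ℂ} {τ ε : ℝ} (hτ : 0 < τ) (hc : c.re = τ)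
    (hε : 0 < ε) :
    ‖(∫ s in Ioo 0 ε, (s ^ 2 : ℝ) • Complex.exp (-(s * c))) - 2 / c ^ 3‖ ≤ 12 / (ε * τ ^ 4) := by
  have hcτ : τ ≤ ‖c‖ := hc ▸ (Complex.re_le_norm c)
  have hc0 : c ≠ 0 := norm_pos_iff.1 (hτ.trans_le hcτ)
  let P : ℝ → ℂ := fun s =>
    -((s : ℂ) ^ 2 / c + 2 * s / c ^ 2 + 2 / c ^ 3) * Complex.exp (-(s * c))
  have hP (s : ℝ) : HasDerivAt P ((s ^ 2 : ℝ) • Complex.exp (-(s * c))) s := by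
    have hs : HasDerivAt (fun s : ℝ => (s : ℂ)) 1 s := Complex.ofRealCLM.hasDerivAt
    have h1 := ((((hs.pow 2).div_const c).add ((hs.const_mul 2).div_const (c ^ 2))).add_const
      (2 / c ^ 3)).neg
    have h2 := ((hs.mul_const c).neg).cexp
    refine (h1.mul h2).congr_deriv ?_
    simp only [Pi.neg_apply, Pi.add_apply, Pi.pow_apply, Complex.real_smul]
    push_cast
    field_simp
    ring
  have hint : ∫ s in Ioo 0 ε, (s ^ 2 : ℝ) • Complex.exp (-(s * c)) = P ε - P 0 := by
    rw [← integral_Ioc_eq_integral_Ioo, ← intervalIntegral.integral_of_le hε.le]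
    refine intervalIntegral.integral_eq_sub_of_hasDerivAt (fun s _ => hP s) ?_
    exact Continuous.intervalIntegrable (by fun_prop) _ _
  have hrem : P ε - P 0 - 2 / c ^ 3 =
      -((ε : ℂ) ^ 2 / c + 2 * ε / c ^ 2 + 2 / c ^ 3) * Complex.exp (-(ε * c)) := by
    simp [P]
  rw [hint, hrem, norm_mul, norm_neg, Complex.norm_exp]
  have hre : (-((ε : ℂ) * c)).re = -(ε * τ) := by simp [hc]
  rw [hre]
  have hq : ‖(ε : ℂ) ^ 2 / c + 2 * ε / c ^ 2 + 2 / c ^ 3‖ ≤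
      ε ^ 2 / τ + 2 * ε / τ ^ 2 + 2 / τ ^ 3 := by
    refine (norm_add₃_le).trans ?_
    simp only [norm_div, norm_mul, norm_pow, Complex.norm_real, Real.norm_of_nonneg hε.le,
      Complex.norm_ofNat]
    gcongr
  calc _ ≤ (ε ^ 2 / τ + 2 * ε / τ ^ 2 + 2 / τ ^ 3) * Real.exp (-(ε * τ)) := by gcongr
    _ = (((ε * τ) ^ 2 + 2 * (ε * τ) + 2) * Real.exp (-(ε * τ))) / τ ^ 3 := by field_simp
    _ ≤ (12 / (ε * τ)) / τ ^ 3 := by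
      gcongr; exact quadratic_mul_exp_neg_le _ (by positivity)
    _ = _ := by field_simp

/-- Dividing by `τ` leaves the ratio `q = √(τ²+k²)/τ`, within `k/τ` of `1`. The reciprocals `x`, `y`
have modulus at most one, because their denominators have real part one, and `x³ - y³ = (x - y)(x² +
xy + y²)` gives the factor `3`. -/
theorem norm_inv_cube_sub_le {k τ b B : ℝ} (hk : 0 ≤ k) (hτ : 0 < τ) (hb : |b| ≤ B) :
    ‖(τ : ℂ) ^ 3 * (2 / ((τ : ℂ) - Complex.I * (√(τ ^ 2 + k ^ 2) * b : ℝ)) ^ 3) -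
      2 * (1 / (1 - Complex.I * (b : ℂ)) ^ 3)‖ ≤ 6 * k * B / τ := by
  set q : ℝ := √(τ ^ 2 + k ^ 2) / τ with hq
  have hB : 0 ≤ B := (abs_nonneg b).trans hb
  have hτ0 : (τ : ℂ) ≠ 0 := by exact_mod_cast hτ.ne'
  have hq1 : |q - 1| ≤ k / τ := by
    have h1 : τ ≤ √(τ ^ 2 + k ^ 2) := Real.le_sqrt_of_sq_le (by nlinarith)
    have h2 : √(τ ^ 2 + k ^ 2) ≤ τ + k := by
      rw [Real.sqrt_le_left (by positivity)]; nlinarith [mul_nonneg hτ.le hk]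
    have h3 : q - 1 = (√(τ ^ 2 + k ^ 2) - τ) / τ := by rw [hq]; field_simp
    rw [h3, abs_of_nonneg (div_nonneg (by linarith) hτ.le)]
    gcongr; linarith
  have hge (r : ℝ) : 1 ≤ ‖1 - Complex.I * (r : ℂ)‖ := by
    have := Complex.re_le_norm (1 - Complex.I * (r : ℂ))
    simpa using this
  have hne (r : ℝ) : 1 - Complex.I * (r : ℂ) ≠ 0 := norm_pos_iff.1 (one_pos.trans_le (hge r))
  set x : ℂ := (1 - Complex.I * (q * b : ℝ))⁻¹
  set y : ℂ := (1 - Complex.I * (b : ℂ))⁻¹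
  have hx : ‖x‖ ≤ 1 := by rw [norm_inv]; exact inv_le_one_of_one_le₀ (hge _)
  have hy : ‖y‖ ≤ 1 := by rw [norm_inv]; exact inv_le_one_of_one_le₀ (hge _)
  have hfac : (τ : ℂ) - Complex.I * (√(τ ^ 2 + k ^ 2) * b : ℝ) =
      τ * (1 - Complex.I * (q * b : ℝ)) := by
    have : √(τ ^ 2 + k ^ 2) = τ * q := by rw [hq]; field_simp
    rw [this]; push_cast; ring
  have hxy : x - y = Complex.I * ((q - 1) * b : ℝ) * (x * y) := by
    have h1 := hne (q * b)
    have h2 := hne b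
    simp only [x, y]
    rw [inv_sub_inv h1 h2, div_eq_mul_inv, mul_inv]
    congr 1
    push_cast; ring
  have hxyn : ‖x - y‖ ≤ k / τ * B := by
    rw [hxy, norm_mul, norm_mul, norm_mul, Complex.norm_I, one_mul, Complex.norm_real,
      Real.norm_eq_abs, abs_mul]
    calc _ ≤ |q - 1| * |b| * (1 * 1) := by gcongr
      _ ≤ k / τ * B := by rw [mul_one, mul_one]; gcongr
  have hmain : (τ : ℂ) ^ 3 * (2 / ((τ : ℂ) - Complex.I * (√(τ ^ 2 + k ^ 2) * b : ℝ)) ^ 3) -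
      2 * (1 / (1 - Complex.I * (b : ℂ)) ^ 3) = 2 * ((x - y) * (x ^ 2 + x * y + y ^ 2)) := by
    have e1 : (τ : ℂ) ^ 3 * (2 / ((τ : ℂ) - Complex.I * (√(τ ^ 2 + k ^ 2) * b : ℝ)) ^ 3) =
        2 * x ^ 3 := by
      rw [hfac, mul_pow]
      simp only [x]
      field_simp
    have e2 : 2 * (1 / (1 - Complex.I * (b : ℂ)) ^ 3) = 2 * y ^ 3 := by
      simp only [y, inv_pow, one_div]
    rw [e1, e2]; ring
  rw [hmain, norm_mul, norm_mul, Complex.norm_ofNat]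
  have hquad : ‖x ^ 2 + x * y + y ^ 2‖ ≤ 3 := by
    refine (norm_add₃_le).trans ?_
    rw [norm_pow, norm_mul, norm_pow]
    nlinarith [norm_nonneg x, norm_nonneg y, mul_le_one₀ hx (norm_nonneg y) hy,
      pow_le_one₀ (norm_nonneg x) hx (n := 2), pow_le_one₀ (norm_nonneg y) hy (n := 2)]
  calc _ ≤ 2 * (k / τ * B * 3) := by gcongr
    _ = _ := by ring

theorem integrableOn_rpow_mul_exp_neg {a τ : ℝ} (ha : 0 < a) (hτ : 0 < τ) :
    IntegrableOn (fun s : ℝ => s ^ (a - 1) * Real.exp (-(τ * s))) (Ioi 0) := by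
  have := integrableOn_rpow_mul_exp_neg_mul_rpow (p := 1) (s := a - 1) (b := τ) (by linarith)
    one_pos hτ
  simpa using this

theorem setIntegral_Ioo_rpow_mul_exp_neg_le {a τ : ℝ} (ha : 0 < a) (hτ : 0 < τ) (ε : ℝ) :
    ∫ s in Ioo 0 ε, s ^ (a - 1) * Real.exp (-(τ * s)) ≤ (1 / τ) ^ a * Real.Gamma a := by
  rw [← Real.integral_rpow_mul_exp_neg_mul_Ioi ha hτ]
  refine setIntegral_mono_set (integrableOn_rpow_mul_exp_neg ha hτ) ?_
    Ioo_subset_Ioi_self.eventuallyLE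
  exact ae_restrict_of_forall_mem measurableSet_Ioi fun s hs =>
    mul_nonneg (Real.rpow_nonneg (le_of_lt hs) _) (Real.exp_pos _).le

/-- In polar form the bound becomes Gamma integrals with weights `s^{2+α}` and `s²`. The separate
`τ⁻¹` leaves room for amplitudes that depend on `τ`. -/
theorem norm_setIntegral_angularCone_le (R : E3 ≃ₗᵢ[ℝ] E3) (p : E3) {A : Set E2} (hA : IsOpen A)
    (hAf : volume A < ∞) {ε K α τ : ℝ} (hα : 0 < α) (hτ : 0 < τ) {Φ : E3 → ℂ}
    (hΦ : IntegrableOn Φ (angularCone R p A ε))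
    (hb : ∀ s ∈ Ioo 0 ε, ∀ y ∈ A,
      ‖Φ (p + s • frame R (y, -1))‖ ≤ K * (s ^ α + τ⁻¹) * Real.exp (-(τ * s)))
    (hK : 0 ≤ K) :
    ‖∫ x in angularCone R p A ε, Φ x‖ ≤ K * volume.real A *
      ((1 / τ) ^ (3 + α) * Real.Gamma (3 + α) + τ⁻¹ * ((1 / τ) ^ (3 : ℝ) * Real.Gamma 3)) := by
  rw [setIntegral_angularCone R p hA ε hΦ]
  have i1 := (integrableOn_rpow_mul_exp_neg (a := 3 + α) (by linarith) hτ).mono_set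
    (Ioo_subset_Ioi_self : Ioo 0 ε ⊆ Ioi 0)
  have i2 := (integrableOn_rpow_mul_exp_neg (a := 3) (by norm_num) hτ).mono_set
    (Ioo_subset_Ioi_self : Ioo 0 ε ⊆ Ioi 0)
  have hle : ‖∫ s in Ioo 0 ε, ∫ y in A, (s ^ 2 : ℝ) • Φ (p + s • frame R (y, -1))‖ ≤
      ∫ s in Ioo 0 ε, K * volume.real A * (s ^ (3 + α - 1) * Real.exp (-(τ * s)) +
        τ⁻¹ * (s ^ ((3 : ℝ) - 1) * Real.exp (-(τ * s)))) := by
    refine norm_integral_le_of_norm_le ((i1.add (i2.const_mul _)).const_mul _) ?_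
    refine ae_restrict_of_forall_mem measurableSet_Ioo fun s hs => ?_
    have h1 : ∀ y ∈ A, ‖(s ^ 2 : ℝ) • Φ (p + s • frame R (y, -1))‖ ≤
        s ^ 2 * (K * (s ^ α + τ⁻¹) * Real.exp (-(τ * s))) := fun y hy => by
      rw [norm_smul, Real.norm_of_nonneg (by positivity)]
      exact mul_le_mul_of_nonneg_left (hb s hs y hy) (by positivity)
    refine (norm_setIntegral_le_of_norm_le_const hAf h1).trans_eq ?_
    have e1 : s ^ (3 + α - 1) = s ^ 2 * s ^ α := by
      rw [← Real.rpow_natCast s 2, ← Real.rpow_add hs.1]; congr 1; push_cast; ring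
    have e2 : s ^ ((3 : ℝ) - 1) = s ^ 2 := by
      rw [← Real.rpow_natCast s 2]; norm_num
    rw [e1, e2]; ring
  refine hle.trans ?_
  rw [integral_const_mul, integral_add i1 (i2.const_mul _), integral_const_mul]
  have b1 := setIntegral_Ioo_rpow_mul_exp_neg_le (a := 3 + α) (by linarith) hτ ε
  have b2 := setIntegral_Ioo_rpow_mul_exp_neg_le (a := 3) (by norm_num) hτ ε
  gcongr

/-- The exponential solution normalised at the apex `p`. -/
noncomputable def apexCgo (k : ℝ) (ω p ϑ : E3) (τ : ℝ) (x : E3) : ℂ :=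
  Complex.exp (-((τ * (dot p ω - dot x ω) : ℝ) -
    Complex.I * (√(τ ^ 2 + k ^ 2) * (dot x ϑ - dot p ϑ) : ℝ)))

theorem scaling_mul_cgo (k : ℝ) (ω p ϑ : E3) (τ : ℝ) (x : E3) :
    scaling k (dot p ω) p ϑ τ * cgo k ω ϑ τ x = (τ : ℂ) ^ 3 * apexCgo k ω p ϑ τ x := by
  rw [scaling, cgo, apexCgo, mul_assoc, mul_assoc, ← Complex.exp_add, ← Complex.exp_add]
  congr 2
  push_cast; ring

theorem norm_apexCgo (k : ℝ) (ω p ϑ : E3) (τ : ℝ) (x : E3) :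
    ‖apexCgo k ω p ϑ τ x‖ = Real.exp (-(τ * (dot p ω - dot x ω))) := by
  rw [apexCgo, Complex.norm_exp]
  simp

theorem continuous_apexCgo (k : ℝ) (ω p ϑ : E3) (τ : ℝ) : Continuous (apexCgo k ω p ϑ τ) := by
  have h1 := continuous_dot_left ω
  have h2 := continuous_dot_left ϑ
  unfold apexCgo
  fun_prop

section Cone

variable {R : E3 ≃ₗᵢ[ℝ] E3} {ω p : E3} {A : Set E2} {B : ℝ}

theorem apexCgo_cone (hR : frame R (0, 1) = ω) (k : ℝ) (ϑ : E3) (τ s : ℝ) (y : E2) :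
    apexCgo k ω p ϑ τ (p + s • frame R (y, -1)) =
      Complex.exp (-(s * ((τ : ℂ) -
        Complex.I * (√(τ ^ 2 + k ^ 2) * dot (frame R (y, -1)) ϑ : ℝ)))) := by
  have h : dot (p + s • frame R (y, -1)) ϑ = dot p ϑ + s * dot (frame R (y, -1)) ϑ := by
    simp only [dot, inner_add_left, inner_smul_left, conj_trivial]
  rw [apexCgo, dot_smul_frame hR, h]
  congr 1
  push_cast; ring

theorem norm_apexCgo_cone (hR : frame R (0, 1) = ω) (k : ℝ) (ϑ : E3) (τ s : ℝ) (y : E2) :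
    ‖apexCgo k ω p ϑ τ (p + s • frame R (y, -1))‖ = Real.exp (-(τ * s)) := by
  rw [norm_apexCgo, dot_smul_frame hR]; ring_nf

theorem volume_lt_top_of_frame_le (hB : ∀ y ∈ A, ‖frame R (y, -1)‖ ≤ B) : volume A < ∞ := by
  refine (Metric.isBounded_closedBall (x := (0 : E2)) (r := B)).subset (fun y hy => ?_)
    |>.measure_lt_top
  rw [mem_closedBall_zero_iff]
  exact (norm_fst_le_norm_frame R (y, -1)).trans (hB y hy)

theorem isBounded_angularCone (hB : ∀ y ∈ A, ‖frame R (y, -1)‖ ≤ B) (ε : ℝ) :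
    Bornology.IsBounded (angularCone R p A ε) := by
  refine (Metric.isBounded_closedBall (x := p) (r := ε * B)).subset ?_
  rintro _ ⟨s, hs, y, hy, rfl⟩
  rw [mem_closedBall_iff_norm, add_sub_cancel_left, norm_smul, Real.norm_of_nonneg hs.1.le]
  exact mul_le_mul hs.2.le (hB y hy) (norm_nonneg _) (hs.1.trans hs.2).le

/-- Asymptotics of the Laplace integral over a truncated cone. -/
theorem norm_setIntegral_apexCgo_sub_le (hR : frame R (0, 1) = ω) (hA : IsOpen A)
    (hB : ∀ y ∈ A, ‖frame R (y, -1)‖ ≤ B) {k : ℝ} (hk : 0 ≤ k) {ε : ℝ} (hε : 0 < ε)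
    {ϑ : E3} (hϑ : ‖ϑ‖ = 1) {τ : ℝ} (hτ : 0 < τ) :
    ‖(τ : ℂ) ^ 3 * (∫ x in angularCone R p A ε, apexCgo k ω p ϑ τ x) - angularConst R A ϑ‖ ≤
      (12 / ε + 6 * k * B) * volume.real A * τ⁻¹ := by
  have hAf := volume_lt_top_of_frame_le hB
  have : IsFiniteMeasure (volume.restrict A) := ⟨by rwa [Measure.restrict_apply_univ]⟩
  have : IsFiniteMeasure (volume.restrict (Ioo 0 ε)) :=
    ⟨by rw [Measure.restrict_apply_univ]; exact measure_Ioo_lt_top⟩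
  have hbdd : Bornology.IsBounded (angularCone R p A ε) := isBounded_angularCone hB ε
  have hint : IntegrableOn (apexCgo k ω p ϑ τ) (angularCone R p A ε) :=
    ((continuous_apexCgo k ω p ϑ τ).continuousOn.integrableOn_compact
      hbdd.isCompact_closure).mono_set subset_closure
  set b : E2 → ℝ := fun y => dot (frame R (y, -1)) ϑ
  have hbc : Continuous b := (continuous_dot_left ϑ).comp (by fun_prop)
  set c : E2 → ℂ := fun y => (τ : ℂ) - Complex.I * (√(τ ^ 2 + k ^ 2) * b y : ℝ)
  have hcc : Continuous c := by fun_prop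
  have hcre (y : E2) : (c y).re = τ := by simp [c]
  have hbB : ∀ y ∈ A, |b y| ≤ B := fun y hy => by
    have := abs_dot_le (frame R (y, -1)) ϑ
    rw [hϑ, mul_one] at this
    exact this.trans (hB y hy)
  rw [setIntegral_angularCone R p hA ε hint]
  simp_rw [apexCgo_cone hR]
  have hprod : Integrable (Function.uncurry fun (s : ℝ) (y : E2) =>
      (s ^ 2 : ℝ) • Complex.exp (-(s * c y)))
      ((volume.restrict (Ioo 0 ε)).prod (volume.restrict A)) := by
    refine Integrable.of_bound (C := ε ^ 2) ?_ ?_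
    · refine Continuous.aestronglyMeasurable ?_
      unfold Function.uncurry
      fun_prop
    · rw [Measure.prod_restrict]
      refine ae_restrict_of_forall_mem (measurableSet_Ioo.prod hA.measurableSet) ?_
      rintro ⟨s, y⟩ ⟨hs, -⟩
      simp only [Function.uncurry]
      rw [norm_smul, Real.norm_of_nonneg (by positivity), Complex.norm_exp]
      have hre : (-((s : ℂ) * c y)).re = -(s * τ) := by simp [hcre]
      have h1 : Real.exp (-(s * τ)) ≤ 1 :=
        Real.exp_le_one_iff.2 (neg_nonpos.2 (mul_nonneg hs.1.le hτ.le))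
      rw [hre]
      calc s ^ 2 * Real.exp (-(s * τ)) ≤ ε ^ 2 * 1 :=
            mul_le_mul (pow_le_pow_left₀ hs.1.le hs.2.le 2) h1 (Real.exp_pos _).le (by positivity)
        _ = ε ^ 2 := mul_one _
  -- With the depth integral innermost, each direction `y` gives a one-dimensional Laplace integral
  -- with a bound uniform in `y`.
  rw [integral_integral_swap hprod, angularConst]
  have hge (r : ℝ) : 1 ≤ ‖1 - Complex.I * (r : ℂ)‖ := by
    simpa using Complex.re_le_norm (1 - Complex.I * (r : ℂ))
  have hne (r : ℝ) : 1 - Complex.I * (r : ℂ) ≠ 0 := norm_pos_iff.1 (one_pos.trans_le (hge r))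
  have hi2 : IntegrableOn (fun y => 1 / (1 - Complex.I * (b y : ℂ)) ^ 3) A := by
    refine Integrable.of_bound (C := 1) ?_ (ae_of_all _ fun y => ?_)
    · refine Continuous.aestronglyMeasurable (Continuous.div continuous_const (by fun_prop) ?_)
      exact fun y => pow_ne_zero 3 (hne _)
    · rw [norm_div, norm_one, norm_pow]
      exact div_le_one_of_le₀ (one_le_pow₀ (hge _)) (by positivity)
  have hi1 : IntegrableOn (fun y => ∫ s in Ioo 0 ε, (s ^ 2 : ℝ) • Complex.exp (-(s * c y))) A :=
    hprod.integral_prod_right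
  rw [← integral_const_mul, ← integral_const_mul, ← integral_sub (hi1.const_mul _)
    (hi2.const_mul _)]
  refine (norm_setIntegral_le_of_norm_le_const (C := (12 / ε + 6 * k * B) * τ⁻¹) hAf
    fun y hy => ?_).trans_eq (by ring)
  have e1 := norm_integral_sq_mul_exp_sub_le hτ (hcre y) hε
  have e2 := norm_inv_cube_sub_le hk hτ (hbB y hy)
  set J := ∫ s in Ioo 0 ε, (s ^ 2 : ℝ) • Complex.exp (-(s * c y))
  calc ‖(τ : ℂ) ^ 3 * J - 2 * (1 / (1 - Complex.I * (b y : ℂ)) ^ 3)‖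
      = ‖(τ : ℂ) ^ 3 * (J - 2 / c y ^ 3) + ((τ : ℂ) ^ 3 * (2 / c y ^ 3) -
          2 * (1 / (1 - Complex.I * (b y : ℂ)) ^ 3))‖ := by congr 1; ring
    _ ≤ τ ^ 3 * (12 / (ε * τ ^ 4)) + 6 * k * B / τ := by
      refine (norm_add_le _ _).trans (add_le_add ?_ e2)
      rw [norm_mul, norm_pow, Complex.norm_real, Real.norm_of_nonneg hτ.le]
      gcongr
    _ = _ := by field_simp

end Cone
/-! ### Asymptotics of the source integral -/

theorem norm_mul_sub_mul_le {a a₀ m m₀ : ℂ} {K₁ K₂ B : ℝ} (ha : ‖a - a₀‖ ≤ K₁) (hm : ‖m‖ ≤ B)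
    (hmm : ‖m - m₀‖ ≤ K₂) : ‖a * m - a₀ * m₀‖ ≤ K₁ * B + ‖a₀‖ * K₂ := by
  have : a * m - a₀ * m₀ = (a - a₀) * m + a₀ * (m - m₀) := by ring
  rw [this]
  refine (norm_add_le _ _).trans ?_
  rw [norm_mul, norm_mul]
  gcongr
  exact (norm_nonneg _).trans ha

theorem inv_le_rpow_neg {α τ : ℝ} (hα : α ≤ 1) (hτ : 1 ≤ τ) : τ⁻¹ ≤ τ ^ (-α) := by
  rw [← Real.rpow_neg_one]
  exact Real.rpow_le_rpow_of_exponent_le hτ (by linarith)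

/-- The contribution of the part of `D` at distance `ε` from the supporting plane. -/
theorem norm_setIntegral_far_le {S : Set E3} (hS : MeasurableSet S) {ρ m : E3 → ℂ}
    (hρ : IntegrableOn ρ S) {k : ℝ} {ω p ϑ : E3} {ε B τ : ℝ} (hε : 0 < ε) (hτ : 0 < τ)
    (hfar : ∀ x ∈ S, ε ≤ dot p ω - dot x ω) (hm : ∀ x ∈ S, ‖m x‖ ≤ B) (hB : 0 ≤ B) :
    ‖(τ : ℂ) ^ 3 * ∫ x in S, ρ x * (m x * apexCgo k ω p ϑ τ x)‖ ≤
      24 / ε ^ 4 * B * (∫ x in S, ‖ρ x‖) * τ⁻¹ := by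
  have h1 : ‖∫ x in S, ρ x * (m x * apexCgo k ω p ϑ τ x)‖ ≤
      ∫ x in S, ‖ρ x‖ * (B * Real.exp (-(ε * τ))) := by
    refine norm_integral_le_of_norm_le (hρ.norm.mul_const _) ?_
    refine ae_restrict_of_forall_mem hS fun x hx => ?_
    rw [norm_mul, norm_mul, norm_apexCgo]
    have : Real.exp (-(τ * (dot p ω - dot x ω))) ≤ Real.exp (-(ε * τ)) :=
      Real.exp_le_exp.2 (by nlinarith [hfar x hx])
    gcongr
    exact hm x hx
  rw [integral_mul_const] at h1
  have h2 := exp_neg_mul_le_inv (ε * τ) (by positivity)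
  have h3 : τ ^ 3 * Real.exp (-(ε * τ)) ≤ 24 / ε ^ 4 * τ⁻¹ := by
    calc _ = ((ε * τ) ^ 3 * Real.exp (-(ε * τ))) / ε ^ 3 := by field_simp
      _ ≤ (24 / (ε * τ)) / ε ^ 3 := by gcongr
      _ = _ := by field_simp
  have h0 : 0 ≤ ∫ x in S, ‖ρ x‖ := integral_nonneg fun _ => norm_nonneg _
  rw [norm_mul, norm_pow, Complex.norm_real, Real.norm_of_nonneg hτ.le]
  calc _ ≤ τ ^ 3 * ((∫ x in S, ‖ρ x‖) * (B * Real.exp (-(ε * τ)))) := by gcongr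
    _ = B * (∫ x in S, ‖ρ x‖) * (τ ^ 3 * Real.exp (-(ε * τ))) := by ring
    _ ≤ B * (∫ x in S, ‖ρ x‖) * (24 / ε ^ 4 * τ⁻¹) := by gcongr
    _ = _ := by ring

section Cone

variable {R : E3 ≃ₗᵢ[ℝ] E3} {ω p : E3} {A : Set E2} {B₀ : ℝ}

/-- Freezing the amplitude at the apex costs a factor `τ ^ (-α)`. -/
theorem norm_setIntegral_freeze_le (hR : frame R (0, 1) = ω) (hA : IsOpen A)
    (hB₀ : ∀ y ∈ A, ‖frame R (y, -1)‖ ≤ B₀) (hB₀0 : 0 ≤ B₀) {ε : ℝ} (hε1 : ε ≤ 1)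
    {α L : ℝ≥0} (hα0 : 0 < α) (hα1 : α ≤ 1) {ρt : E3 → ℂ}
    (hρt : ∀ x ∈ angularCone R p A ε, ‖ρt x - ρt p‖ ≤ L * ‖x - p‖ ^ (α : ℝ))
    {k : ℝ} {ϑ : E3} {B τ : ℝ} (hτ : 0 < τ) {m : E3 → ℂ} {m₀ : ℂ}
    (hint : IntegrableOn (fun x => (ρt x * m x - ρt p * m₀) * apexCgo k ω p ϑ τ x)
      (angularCone R p A ε)) (hB : 0 ≤ B)
    (hm : ∀ x ∈ angularCone R p A ε, ‖m x‖ ≤ B)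
    (hmm : ∀ x ∈ angularCone R p A ε, ‖m x - m₀‖ ≤ B * (‖x - p‖ + τ⁻¹)) :
    ‖(τ : ℂ) ^ 3 * ∫ x in angularCone R p A ε,
        (ρt x * m x - ρt p * m₀) * apexCgo k ω p ϑ τ x‖ ≤
      (B * (L * B₀ ^ (α : ℝ) + ‖ρt p‖ * (B₀ + 1)) * volume.real A) *
        (Real.Gamma (3 + α) * τ ^ (-(α : ℝ)) + Real.Gamma 3 * τ⁻¹) := by
  have hα0' : (0 : ℝ) < α := by exact_mod_cast hα0
  have hα1' : (α : ℝ) ≤ 1 := by exact_mod_cast hα1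
  have hmain := norm_setIntegral_angularCone_le R p hA (volume_lt_top_of_frame_le hB₀)
    (K := B * (L * B₀ ^ (α : ℝ) + ‖ρt p‖ * (B₀ + 1))) hα0' hτ hint ?_ (by positivity)
  · rw [norm_mul, norm_pow, Complex.norm_real, Real.norm_of_nonneg hτ.le]
    refine (mul_le_mul_of_nonneg_left hmain (by positivity)).trans_eq ?_
    have e1 : τ ^ 3 * (1 / τ) ^ (3 + (α : ℝ)) = τ ^ (-(α : ℝ)) := by
      rw [one_div, Real.inv_rpow hτ.le, ← Real.rpow_neg hτ.le, ← Real.rpow_natCast τ 3,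
        ← Real.rpow_add hτ]
      congr 1; push_cast; ring
    have e2 : τ ^ 3 * (1 / τ) ^ (3 : ℝ) = 1 := by
      rw [one_div, Real.inv_rpow hτ.le, ← Real.rpow_natCast τ 3]
      exact mul_inv_cancel₀ (by positivity)
    rw [← e1]
    linear_combination (B * (L * B₀ ^ (α : ℝ) + ‖ρt p‖ * (B₀ + 1)) * volume.real A) * τ⁻¹ *
      Real.Gamma 3 * e2
  · intro s hs y hy
    have hx : p + s • frame R (y, -1) ∈ angularCone R p A ε := ⟨s, hs, y, hy, rfl⟩
    rw [norm_mul, norm_apexCgo_cone hR]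
    refine mul_le_mul_of_nonneg_right ?_ (Real.exp_pos _).le
    have hd : ‖p + s • frame R (y, -1) - p‖ ≤ s * B₀ := by
      rw [add_sub_cancel_left, norm_smul, Real.norm_of_nonneg hs.1.le]
      exact mul_le_mul_of_nonneg_left (hB₀ y hy) hs.1.le
    -- Here `s < ε ≤ 1` is used: the linear variation of `m` is absorbed into the Hölder order.
    have hsα : s ≤ s ^ (α : ℝ) := by
      conv_lhs => rw [← Real.rpow_one s]
      exact Real.rpow_le_rpow_of_exponent_ge hs.1 (hs.2.le.trans hε1) hα1'
    have hpow : ‖p + s • frame R (y, -1) - p‖ ^ (α : ℝ) ≤ s ^ (α : ℝ) * B₀ ^ (α : ℝ) := by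
      rw [← Real.mul_rpow hs.1.le hB₀0]
      exact Real.rpow_le_rpow (norm_nonneg _) hd hα0'.le
    have h1 : ‖ρt (p + s • frame R (y, -1)) - ρt p‖ ≤ L * (s ^ (α : ℝ) * B₀ ^ (α : ℝ)) :=
      (hρt _ hx).trans (mul_le_mul_of_nonneg_left hpow L.2)
    have h2 : ‖m (p + s • frame R (y, -1)) - m₀‖ ≤ B * (s ^ (α : ℝ) * B₀ + τ⁻¹) := by
      refine (hmm _ hx).trans ?_
      gcongr
      exact hd.trans (by gcongr)
    refine (norm_mul_sub_mul_le h1 (hm _ hx) h2).trans ?_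
    have hs0 : 0 ≤ s ^ (α : ℝ) := Real.rpow_nonneg hs.1.le _
    have hp1 : 0 ≤ B * L * B₀ ^ (α : ℝ) * τ⁻¹ := by positivity
    have hp2 : 0 ≤ B * ‖ρt p‖ * s ^ (α : ℝ) := by positivity
    have hp3 : 0 ≤ B * ‖ρt p‖ * B₀ * τ⁻¹ := by positivity
    nlinarith

/-- Uniform asymptotics of the integral of `ρ m v` over a set with a conical point. -/
theorem exists_asymptotics {D : Set E3} (hDo : IsOpen D) (hDb : Bornology.IsBounded D)
    {ρ ρt : E3 → ℂ} (hρ : IntegrableOn ρ D) (hR : frame R (0, 1) = ω) (hA : IsOpen A)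
    (hB₀ : ∀ y ∈ A, ‖frame R (y, -1)‖ ≤ B₀) (hB₀0 : 0 < B₀) {ε η : ℝ} (hε : 0 < ε) (hε1 : ε ≤ 1)
    (hη : 0 < η) (hεη : ε * B₀ ≤ η) (hsub : angularCone R p A ε ⊆ D)
    (hfar : ∀ x ∈ D \ angularCone R p A ε, ε ≤ dot p ω - dot x ω)
    {α L : ℝ≥0} (hα0 : 0 < α) (hα1 : α ≤ 1)
    (hρt : HolderOnWith L α ρt (Metric.closedBall p η))
    (hρρt : ∀ᵐ x ∂(volume.restrict (Metric.ball p η ∩ D)), ρ x = ρt x)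
    {k : ℝ} (hk : 0 ≤ k) {B : ℝ} (hB : 0 ≤ B) :
    ∃ M, ∀ ϑ : E3, ‖ϑ‖ = 1 → ∀ τ ≥ (1 : ℝ), ∀ (m : E3 → ℂ) (m₀ : ℂ), Continuous m →
      (∀ x ∈ D, ‖m x‖ ≤ B) → ‖m₀‖ ≤ B → (∀ x ∈ D, ‖m x - m₀‖ ≤ B * (‖x - p‖ + τ⁻¹)) →
      ‖(τ : ℂ) ^ 3 * (∫ x in D, ρ x * (m x * apexCgo k ω p ϑ τ x)) -
        ρt p * m₀ * angularConst R A ϑ‖ ≤ M * τ ^ (-(α : ℝ)) := by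
  set C := angularCone R p A ε
  have hCo : IsOpen C := isOpen_angularCone R p hA ε
  have hCb : Bornology.IsBounded C := hDb.subset hsub
  have hα1' : (α : ℝ) ≤ 1 := by exact_mod_cast hα1
  have hCball : C ⊆ Metric.ball p η := by
    rintro _ ⟨s, hs, y, hy, rfl⟩
    rw [mem_ball_iff_norm, add_sub_cancel_left, norm_smul, Real.norm_of_nonneg hs.1.le]
    calc s * ‖frame R (y, -1)‖ ≤ s * B₀ := by gcongr; exacts [hs.1.le, hB₀ y hy]
      _ < ε * B₀ := by gcongr; exact hs.2
      _ ≤ η := hεη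
  have hae : ∀ᵐ x ∂(volume.restrict C), ρ x = ρt x :=
    ae_restrict_of_ae_restrict_of_subset (subset_inter hCball hsub) hρρt
  have hρC : IntegrableOn ρ C := hρ.mono_set hsub
  have hρtC : IntegrableOn ρt C := hρC.congr hae
  have hholder : ∀ x ∈ C, ‖ρt x - ρt p‖ ≤ L * ‖x - p‖ ^ (α : ℝ) := fun x hx => by
    have := hρt.dist_le (Metric.ball_subset_closedBall (hCball hx))
      (Metric.mem_closedBall_self hη.le)
    rwa [dist_eq_norm, dist_eq_norm] at this
  have hmulC {f h : E3 → ℂ} {S : Set E3} (hSo : MeasurableSet S) (hSb : Bornology.IsBounded S)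
      (hf : IntegrableOn f S) (hh : Continuous h) : IntegrableOn (fun x => f x * h x) S :=
    hf.mul_continuousOn_of_subset hh.continuousOn hSo hSb.isCompact_closure subset_closure
  -- The three summands bound the far part, the freezing error and the truncated Laplace integral.
  -- None involves `ϑ`, `τ` or the amplitude `m`.
  refine ⟨24 / ε ^ 4 * B * (∫ x in D \ C, ‖ρ x‖) +
    (B * (L * B₀ ^ (α : ℝ) + ‖ρt p‖ * (B₀ + 1)) * volume.real A) *
      (Real.Gamma (3 + α) + Real.Gamma 3) +
    ‖ρt p‖ * B * ((12 / ε + 6 * k * B₀) * volume.real A), ?_⟩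
  intro ϑ hϑ τ hτ1 m m₀ hmc hm hm₀ hmm
  have hτ : 0 < τ := one_pos.trans_le hτ1
  have hE := continuous_apexCgo k ω p ϑ τ
  have hGamma3 : 0 ≤ Real.Gamma 3 := (Real.Gamma_pos_of_pos (by norm_num)).le
  have hτα := inv_le_rpow_neg hα1' hτ1
  have hiC : IntegrableOn (fun x => ρt x * (m x * apexCgo k ω p ϑ τ x)) C :=
    hmulC hCo.measurableSet hCb hρtC (hmc.mul hE)
  have hiE : IntegrableOn (apexCgo k ω p ϑ τ) C :=
    (hE.continuousOn.integrableOn_compact hCb.isCompact_closure).mono_set subset_closure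
  have hiF : IntegrableOn (fun x => (ρt x * m x - ρt p * m₀) * apexCgo k ω p ϑ τ x) C := by
    have h2 : (fun x => (ρt x * m x - ρt p * m₀) * apexCgo k ω p ϑ τ x) =
      fun x => ρt x * (m x * apexCgo k ω p ϑ τ x) - ρt p * m₀ * apexCgo k ω p ϑ τ x := by
        ext x; ring
    rw [h2]
    exact hiC.sub (hiE.const_mul _)
  have hiD : IntegrableOn (fun x => ρ x * (m x * apexCgo k ω p ϑ τ x)) D :=
    hmulC hDo.measurableSet hDb hρ (hmc.mul hE)
  -- On the cone the amplitude `ρ̃ m` is written as its value at the apex plus a deviation; off the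
  -- cone nothing but integrability of `ρ` is needed.
  have hsplit : ∫ x in D, ρ x * (m x * apexCgo k ω p ϑ τ x) =
      (∫ x in D \ C, ρ x * (m x * apexCgo k ω p ϑ τ x)) +
      ((∫ x in C, (ρt x * m x - ρt p * m₀) * apexCgo k ω p ϑ τ x) +
        ρt p * m₀ * ∫ x in C, apexCgo k ω p ϑ τ x) := by
    have h1 : ∫ x in C, ρ x * (m x * apexCgo k ω p ϑ τ x) =
        ∫ x in C, ((ρt x * m x - ρt p * m₀) * apexCgo k ω p ϑ τ x +
          ρt p * m₀ * apexCgo k ω p ϑ τ x) :=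
      integral_congr_ae (hae.mono fun x hx => by simp only [hx]; ring)
    rw [← integral_const_mul, ← integral_add hiF (hiE.const_mul _), ← h1,
      ← integral_inter_add_sdiff hCo.measurableSet hiD, inter_eq_right.2 hsub, add_comm]
  have b1 := norm_setIntegral_far_le (hDo.measurableSet.diff hCo.measurableSet)
    (hρ.mono_set sdiff_subset) (k := k) (ϑ := ϑ) hε hτ hfar (fun x hx => hm x hx.1) hB
  have b2 := norm_setIntegral_freeze_le hR hA hB₀ hB₀0.le hε1 hα0 hα1 hholder hτ hiF hB
    (fun x hx => hm x (hsub hx)) (fun x hx => hmm x (hsub hx))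
  have b3 := norm_setIntegral_apexCgo_sub_le (p := p) hR hA hB₀ hk hε hϑ hτ
  have hnn : 0 ≤ ∫ x in D \ C, ‖ρ x‖ := integral_nonneg fun _ => norm_nonneg _
  have hρm : ‖ρt p * m₀‖ ≤ ‖ρt p‖ * B := by rw [norm_mul]; gcongr
  set I₁ := ∫ x in D \ C, ρ x * (m x * apexCgo k ω p ϑ τ x)
  set I₂ := ∫ x in C, (ρt x * m x - ρt p * m₀) * apexCgo k ω p ϑ τ x
  set I₃ := ∫ x in C, apexCgo k ω p ϑ τ x
  rw [hsplit]
  calc _ = ‖(τ : ℂ) ^ 3 * I₁ + (τ : ℂ) ^ 3 * I₂ +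
        ρt p * m₀ * ((τ : ℂ) ^ 3 * I₃ - angularConst R A ϑ)‖ := by congr 1; ring
    _ ≤ 24 / ε ^ 4 * B * (∫ x in D \ C, ‖ρ x‖) * τ⁻¹ +
        (B * (L * B₀ ^ (α : ℝ) + ‖ρt p‖ * (B₀ + 1)) * volume.real A) *
          (Real.Gamma (3 + α) * τ ^ (-(α : ℝ)) + Real.Gamma 3 * τ⁻¹) +
        ‖ρt p‖ * B * ((12 / ε + 6 * k * B₀) * volume.real A * τ⁻¹) := by
      refine (norm_add₃_le).trans (add_le_add (add_le_add b1 b2) ?_)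
      rw [norm_mul]
      gcongr
    _ ≤ 24 / ε ^ 4 * B * (∫ x in D \ C, ‖ρ x‖) * τ ^ (-(α : ℝ)) +
        (B * (L * B₀ ^ (α : ℝ) + ‖ρt p‖ * (B₀ + 1)) * volume.real A) *
          (Real.Gamma (3 + α) * τ ^ (-(α : ℝ)) + Real.Gamma 3 * τ ^ (-(α : ℝ))) +
        ‖ρt p‖ * B * ((12 / ε + 6 * k * B₀) * volume.real A * τ ^ (-(α : ℝ))) := by
      gcongr
    _ = _ := by ring

end Cone

/-- The amplitude of `v_τ` is close to its value at the apex. -/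
theorem norm_cgoFactor_sub_le {k : ℝ} (hk : 0 ≤ k) {ω ϑ : E3} (hω : ‖ω‖ = 1) (hϑ : ‖ϑ‖ = 1)
    {τ : ℝ} (hτ : 0 < τ) (x p : E3) :
    ‖cgoFactor k ω ϑ τ x - ((dot p ω : ℂ) + Complex.I * (dot p ϑ : ℂ))‖ ≤
      2 * ‖x - p‖ + k * ‖p‖ * τ⁻¹ := by
  set q := τ / √(τ ^ 2 + k ^ 2) with hq
  have hs : 0 < √(τ ^ 2 + k ^ 2) := by positivity
  have hq1 : |q - 1| ≤ k * τ⁻¹ := by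
    have h1 : τ ≤ √(τ ^ 2 + k ^ 2) := Real.le_sqrt_of_sq_le (by nlinarith)
    have h2 : √(τ ^ 2 + k ^ 2) ≤ τ + k := by
      rw [Real.sqrt_le_left (by positivity)]; nlinarith [mul_nonneg hτ.le hk]
    have h3 : q - 1 = -((√(τ ^ 2 + k ^ 2) - τ) / √(τ ^ 2 + k ^ 2)) := by rw [hq]; field_simp; ring
    rw [h3, abs_neg, abs_of_nonneg (div_nonneg (by linarith) hs.le), ← div_eq_mul_inv]
    gcongr; linarith
  have hq0 : 0 ≤ q := by positivity
  have hqle : q ≤ 1 := div_sqrt_sq_add_le_one τ k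
  have hdec : cgoFactor k ω ϑ τ x - ((dot p ω : ℂ) + Complex.I * (dot p ϑ : ℂ)) =
      (dot (x - p) ω : ℝ) + Complex.I * (q * dot (x - p) ϑ : ℝ) +
        Complex.I * ((q - 1) * dot p ϑ : ℝ) := by
    rw [cgoFactor, ← hq]
    simp only [dot, inner_sub_left]
    push_cast; ring
  have h1 := abs_dot_le (x - p) ω
  have h2 := abs_dot_le (x - p) ϑ
  have h3 := abs_dot_le p ϑ
  rw [hω, mul_one] at h1
  rw [hϑ, mul_one] at h2 h3
  rw [hdec]
  refine norm_add₃_le.trans ?_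
  simp only [norm_mul, Complex.norm_I, one_mul, Complex.norm_real, Real.norm_eq_abs,
    abs_of_nonneg hq0]
  have h4 : q * |dot (x - p) ϑ| ≤ 1 * ‖x - p‖ := mul_le_mul hqle h2 (abs_nonneg _) zero_le_one
  have h5 : |q - 1| * |dot p ϑ| ≤ k * τ⁻¹ * ‖p‖ := mul_le_mul hq1 h3 (abs_nonneg _) (by positivity)
  linarith

/-- An open set never reaches its supporting plane, since any of its points can be pushed further
along `ω`. This supplies the strict upper inequality in the slab where the cone describes `D`. -/
theorem dot_lt_supportFn {D : Set E3} (hDo : IsOpen D) (hDb : Bornology.IsBounded D) {ω : E3}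
    (hω : ‖ω‖ = 1) {x : E3} (hx : x ∈ D) : dot x ω < supportFn D ω := by
  obtain ⟨C, hC⟩ := hDb.exists_norm_le
  have hbdd : BddAbove ((fun x => dot x ω) '' D) := by
    refine ⟨C, ?_⟩
    rintro _ ⟨y, hy, rfl⟩
    have := (le_abs_self _).trans (abs_dot_le y ω)
    rw [hω, mul_one] at this
    exact this.trans (hC y hy)
  have hcont : Tendsto (fun t : ℝ => x + t • ω) (𝓝[>] 0) (𝓝 x) := by
    have : Continuous fun t : ℝ => x + t • ω := by fun_prop
    simpa using (this.tendsto 0).mono_left nhdsWithin_le_nhds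
  obtain ⟨t, htD, ht⟩ := ((hcont.eventually (hDo.mem_nhds hx)).and self_mem_nhdsWithin).exists
  have h1 : dot (x + t • ω) ω = dot x ω + t := by
    simp [dot, inner_add_left, inner_smul_left, hω]
  have h2 : dot (x + t • ω) ω ≤ supportFn D ω := le_csSup hbdd ⟨_, htD, rfl⟩
  have ht : 0 < t := ht
  linarith

/-! ### The derivative identity and the two uniform expansions -/

theorem theorem1p1
    (Ω : Set E3) (hΩ : IsBoundedC2Domain Ω)
    (k : ℝ) (hk : 0 ≤ k)
    (D : Set E3) (hDo : IsOpen D) (hDne : D.Nonempty) (hDΩ : closure D ⊆ Ω)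
    (ρ : E3 → ℂ) (hρ : MemLp ρ 2 (volume.restrict D))
    -- a weak solution `u` with its Cauchy data
    (u : E3 → ℂ) (G : Fin 3 → E3 → ℂ) (hu : IsWeakSolution Ω k (source ρ D) u G)
    (g : E3 → ℂ) (Λ : (E3 → ℂ) → ℂ) (hC : IsCauchyData Ω k (source ρ D) u G g Λ)
    -- the direction and the conical singularity
    (ω : E3) (hω : ‖ω‖ = 1) (p : E3) (hp : IsRegularDirection D ω p)
    (δ : ℝ) (Q : Set E3) (hcone : HasConicalSingularity D ω p δ Q)
    -- near `p` the strength `ρ` is Hölder continuous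
    (η : ℝ) (hη : 0 < η) (α : ℝ≥0) (hα0 : 0 < α) (hα1 : α ≤ 1)
    (ρt : E3 → ℂ) (hρt : ∃ L : ℝ≥0, HolderOnWith L α ρt (Metric.closedBall p η))
    (hρρt : ∀ᵐ x ∂(volume.restrict (Metric.ball p η ∩ D)), ρ x = ρt x) :
    (∀ ϑ ∈ perpSphere ω, ∀ τ > (0 : ℝ),
      HasDerivAt (indicatorFn Ω k g Λ ω ϑ) (indicatorFnDeriv Ω k g Λ ω ϑ τ) τ) ∧
    ∃ M τ₀ : ℝ, 0 < τ₀ ∧ ∀ s ∈ Ioo 0 δ, ∀ ϑ ∈ perpSphere ω, ∀ τ ≥ τ₀,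
      ‖scaling k (supportFn D ω) p ϑ τ * indicatorFn Ω k g Λ ω ϑ τ
          - ρt p * coneConst p ω δ Q ϑ s‖ ≤ M * τ ^ (-(α : ℝ)) ∧
      ‖scaling k (supportFn D ω) p ϑ τ * indicatorFnDeriv Ω k g Λ ω ϑ τ
          - ρt p * ((supportFn D ω : ℂ) + Complex.I * (dot p ϑ : ℂ)) * coneConst p ω δ Q ϑ s‖
        ≤ M * τ ^ (-(α : ℝ)) := by
  have hDsub : D ⊆ Ω := subset_closure.trans hDΩ
  have hDb : Bornology.IsBounded D := hΩ.isBounded.subset hDsub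
  have hfin : IsFiniteMeasure (volume.restrict D) :=
    ⟨by rw [Measure.restrict_apply_univ]; exact hDb.measure_lt_top⟩
  have hρ1 : IntegrableOn ρ D := hρ.integrable one_le_two
  have hpf : p ∈ supportFace D ω := by rw [hp]; rfl
  have hsupp : supportFn D ω = dot p ω := hpf.2.symm
  refine ⟨fun ϑ hϑ τ hτ => ?_, ?_⟩
  · rw [indicatorFnDeriv_eq hΩ hDo hDsub hρ hu.isH1 hC hω hϑ hτ]
    -- The volume formula holds for every real `τ`, so it may replace the indicator as a function
    -- before differentiation.
    have : indicatorFn Ω k g Λ ω ϑ = fun τ => ∫ x in D, ρ x * cgo k ω ϑ τ x :=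
      funext fun t => indicatorFn_eq hΩ hDo hDsub hρ hu.isH1 hC hω hϑ t
    rw [this]
    exact hasDerivAt_integral_cgo hDo hDb hρ1 k hω hϑ.1 hτ
  obtain ⟨hδ, hQ, hDQ⟩ := hcone
  obtain ⟨R, hR⟩ := exists_frame_eq hω
  obtain ⟨L, hL⟩ := hρt
  set A := angularBase R p δ Q
  have hA : IsOpen A := hQ.isOpen_angularBase hR
  obtain ⟨B₀, hB₀0, hB₀⟩ := hQ.exists_norm_le (R := R) hδ
  obtain ⟨C, hCD⟩ := hDb.exists_norm_le
  have hC0 : 0 ≤ C := by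
    obtain ⟨x, hx⟩ := hDne
    exact (norm_nonneg x).trans (hCD x hx)
  -- The three bounds keep the truncated cone inside the given cone, make `s ≤ s^α` available, and
  -- place the truncated cone in the ball where `ρ̃` is Hölder.
  set ε := min (min δ 1) (η / B₀)
  have hε : 0 < ε := lt_min (lt_min hδ one_pos) (by positivity)
  have hεδ : ε ≤ δ := (min_le_left _ _).trans (min_le_left _ _)
  have hε1 : ε ≤ 1 := (min_le_left _ _).trans (min_le_right _ _)
  have hεη : ε * B₀ ≤ η := (le_div_iff₀ hB₀0).1 (min_le_right _ _)
  rw [hQ.cone_eq hδ hR] at hDQ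
  have hsub : angularCone R p A ε ⊆ D := by
    rintro _ ⟨s, hs, y, hy, rfl⟩
    have : p + s • frame R (y, -1) ∈ angularCone R p A δ :=
      ⟨s, ⟨hs.1, hs.2.trans_le hεδ⟩, y, hy, rfl⟩
    rw [← hDQ] at this
    exact this.1
  -- A point of `D` at depth less than `ε` lies in the cone of height `δ`, where its parameter `s`
  -- is that depth; so it already lies in the truncated cone.
  have hfar : ∀ x ∈ D \ angularCone R p A ε, ε ≤ dot p ω - dot x ω := by
    rintro x ⟨hxD, hxC⟩
    by_contra hlt
    push Not at hlt
    have hx : x ∈ angularCone R p A δ := by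
      rw [← hDQ]
      exact ⟨hxD, by rw [hsupp]; linarith, dot_lt_supportFn hDo hDb hω hxD⟩
    obtain ⟨s, hs, y, hy, rfl⟩ := hx
    rw [dot_smul_frame hR] at hlt
    exact hxC ⟨s, ⟨hs.1, by linarith⟩, y, hy, rfl⟩
  -- One constant for both amplitudes: `2C` bounds `x·∂_τζ` on `D`, `2‖p‖` bounds its limit at the
  -- apex, and `2` and `k‖p‖` are the coefficients of its deviation. The `2` also covers the
  -- amplitude `1`.
  set B := 2 + 2 * C + 2 * ‖p‖ + k * ‖p‖
  have hkp : 0 ≤ k * ‖p‖ := by positivity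
  have hp0 := norm_nonneg p
  have hB : 0 ≤ B := by positivity
  obtain ⟨M, hM⟩ := exists_asymptotics hDo hDb hρ1 hR hA hB₀ hB₀0 hε hε1 hη hεη hsub hfar hα0 hα1
    hL hρρt hk hB
  refine ⟨M, 1, one_pos, fun s hs ϑ hϑ τ hτ => ?_⟩
  have hτ0 : 0 < τ := one_pos.trans_le hτ
  have hτi : 0 ≤ τ⁻¹ := by positivity
  rw [hQ.coneConst_eq hδ hR ϑ hs, hsupp]
  constructor
  · have h := hM ϑ hϑ.1 τ hτ (fun _ => 1) 1 continuous_const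
      (fun x _ => by rw [norm_one]; linarith) (by rw [norm_one]; linarith)
      (fun x _ => by rw [sub_self, norm_zero]; positivity)
    have hI : scaling k (dot p ω) p ϑ τ * (∫ x in D, ρ x * cgo k ω ϑ τ x) =
        (τ : ℂ) ^ 3 * ∫ x in D, ρ x * (1 * apexCgo k ω p ϑ τ x) := by
      rw [← integral_const_mul, ← integral_const_mul]
      refine integral_congr_ae (ae_of_all _ fun x => ?_)
      simp only
      rw [mul_left_comm, scaling_mul_cgo]; ring
    rwa [indicatorFn_eq hΩ hDo hDsub hρ hu.isH1 hC hω hϑ, hI, ← mul_one (ρt p)]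
  -- The amplitude depends on `τ`; its limiting value at the apex is `p·(ω + iϑ)`, and the
  -- discrepancy is the `τ⁻¹` allowed in the deviation bound.
  · have h := hM ϑ hϑ.1 τ hτ (cgoFactor k ω ϑ τ) ((dot p ω : ℂ) + Complex.I * (dot p ϑ : ℂ))
      (continuous_cgoFactor k ω ϑ τ)
      (fun x hx => (norm_cgoFactor_le k hω hϑ.1 hτ0 x).trans (by linarith [hCD x hx])) ?_ ?_
    · have hI : scaling k (dot p ω) p ϑ τ * (∫ x in D, ρ x * cgoDeriv k ω ϑ τ x) =
          (τ : ℂ) ^ 3 * ∫ x in D, ρ x * (cgoFactor k ω ϑ τ x * apexCgo k ω p ϑ τ x) := by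
        rw [← integral_const_mul, ← integral_const_mul]
        refine integral_congr_ae (ae_of_all _ fun x => ?_)
        simp only
        rw [cgoDeriv_eq_factor_mul, mul_left_comm, mul_left_comm _ (cgoFactor k ω ϑ τ x),
          scaling_mul_cgo]
        ring
      rwa [indicatorFnDeriv_eq hΩ hDo hDsub hρ hu.isH1 hC hω hϑ hτ0, hI]
    · refine (norm_add_le _ _).trans ?_
      rw [norm_mul, Complex.norm_I, one_mul, Complex.norm_real, Complex.norm_real,
        Real.norm_eq_abs, Real.norm_eq_abs]
      have h1 := abs_dot_le p ω
      have h2 := abs_dot_le p ϑ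
      rw [hω, mul_one] at h1
      rw [hϑ.1, mul_one] at h2
      linarith
    · intro x _
      refine (norm_cgoFactor_sub_le hk hω hϑ.1 hτ0 x p).trans ?_
      rw [mul_add]
      gcongr <;> linarith
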